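/- Let $\Delta^{n-1}$ denote the standard simplex with $n$ vertices in $\mathbb R^n$. A cell of a polytope $P$ is a polytope of the same dimension as $P$ all of whose vertices are vertices of $P$. A subdivision of $P$ is a family of cells that cover $P$ and any two of which intersect in a common (possibly empty) face. A subdivision $S$ is regular if there is a height function $h:\mathrm{vertices}(P)\to\mathbb R$ such that for every cell $B\in S$ the points $(v,h(v))$ with $v\in B$ lie in a hyperplane that passes strictly below all the other points $(w,h(w))$, $w\notin B$. Subdivisions are counted as labeled objects, not up to symmetry. For every fixed $l\ge 2$, the number of regular subdivisions of $\Delta^{l-1}\times\Delta^{k-1}$ is $k^{\Theta(k)}$ as $k\to\infty$; that is, there are constants $c,C>0$, depending only on $l$, such that for all sufficiently large $k$ this number lies between $k^{ck}$ and $k^{Ck}$. For every fixed $l\ge 3$, the number of all subdivisions of $\Delta^{l-1}\times\Delta^{k-1}$ is $2^{\Omega(k^2)}$, and so is the number of non-regular subdivisions; that is, there is a constant $c>0$, depending only on $l$, such that for all sufficiently large $k$ each of the two numbers is at least $2^{ck^2}$. In particular the proportion of regular subdivisions among all subdivisions of $\Delta^{l-1}\times\Delta^{k-1}$ tends to $0$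 as $k\to\infty$. -/

import Mathlib

open Filter Topology

section Polytopes

variable {E : Type*} [AddCommGroup E] [Module ℝ E]

/-- `B` is a cell of the polytope `P`: a polytope whose vertices are among the vertices of `P`,
of the same dimension as `P` (as `B ⊆ P`, this means that `B` and `P` have the same affine
span). -/
def IsPolytopeCell (P B : Set E) : Prop :=
  (∃ V : Set E, V ⊆ P.extremePoints ℝ ∧ B = convexHull ℝ V) ∧ affineSpan ℝ B = affineSpan ℝ P

/-- `S` is a polyhedral subdivision of the polytope `P`: a family of cells that cover `P`, any two
of which intersect in a common face (possibly empty). Faces of a polytope are its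
exposed subsets, the empty set and the polytope itself included. -/
structure IsPolySubdivision [TopologicalSpace E] (P : Set E) (S : Set (Set E)) : Prop where
  isCell : ∀ B ∈ S, IsPolytopeCell P B
  cover : ⋃₀ S = P
  inter_left : ∀ B ∈ S, ∀ B' ∈ S, IsExposed ℝ B (B ∩ B')
  inter_right : ∀ B ∈ S, ∀ B' ∈ S, IsExposed ℝ B' (B ∩ B')

/-- The subdivision `S` of `P` is regular: there is a height function `h` on the vertices of `P`
(only its values there matter) such that for each cell `B` of `S` the lifted vertices lying in `B`
are on a hyperplane (the graph of an affine function `φ`) that passes strictly below all the other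
lifted vertices. -/
def IsRegularSubdivision [TopologicalSpace E] (P : Set E) (S : Set (Set E)) : Prop :=
  IsPolySubdivision P S ∧
    ∃ h : E → ℝ, ∀ B ∈ S, ∃ φ : E →ᵃ[ℝ] ℝ, ∀ v ∈ P.extremePoints ℝ,
      (v ∈ B → φ v = h v) ∧ (v ∉ B → φ v < h v)

/-- A polytope (with finitely many vertices) has finitely many subdivisions, so the cardinalities
`Set.ncard` below are honest. -/
theorem finite_isPolySubdivision [TopologicalSpace E] {P : Set E}
    (hP : (P.extremePoints ℝ).Finite) : {S | IsPolySubdivision P S}.Finite := by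
  refine ((hP.finite_subsets.image (fun V => convexHull ℝ V)).finite_subsets).subset ?_
  rintro S hS B hB
  obtain ⟨⟨V, hV, rfl⟩, -⟩ := hS.isCell B hB
  exact ⟨V, hV, rfl⟩

end Polytopes

/-- The product of simplices `Δ^{l-1} × Δ^{k-1}`, where `Δ^{n-1}` is the standard simplex in
`ℝ^n`. -/
def simplexProd (l k : ℕ) : Set ((Fin l → ℝ) × (Fin k → ℝ)) :=
  stdSimplex ℝ (Fin l) ×ˢ stdSimplex ℝ (Fin k)

theorem finite_extremePoints_simplexProd (l k : ℕ) :
    ((simplexProd l k).extremePoints ℝ).Finite := by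
  have key : ∀ n : ℕ, ((stdSimplex ℝ (Fin n)).extremePoints ℝ).Finite := by
    intro n
    rw [← convexHull_basis_eq_stdSimplex]
    exact (Set.finite_range _).subset extremePoints_convexHull_subset
  rw [simplexProd, extremePoints_prod]
  exact (key l).prod (key k)

/-- The number of all polyhedral subdivisions of `Δ^{l-1} × Δ^{k-1}`. -/
noncomputable def numSubdivisions (l k : ℕ) : ℕ :=
  {S | IsPolySubdivision (simplexProd l k) S}.ncard

/-- The number of regular subdivisions of `Δ^{l-1} × Δ^{k-1}`. -/
noncomputable def numRegularSubdivisions (l k : ℕ) : ℕ :=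
  {S | IsRegularSubdivision (simplexProd l k) S}.ncard

/-- The number of non-regular subdivisions of `Δ^{l-1} × Δ^{k-1}`. -/
noncomputable def numNonregularSubdivisions (l k : ℕ) : ℕ :=
  {S | IsPolySubdivision (simplexProd l k) S ∧ ¬ IsRegularSubdivision (simplexProd l k) S}.ncard

/-! The vertices of the product are the edges (i, j) of a complete bipartite graph on rows and
columns. On them an affine function is a potential `a i + b j`, and a full-dimensional cell is a
connected spanning set of edges. A regular subdivision consists of the sets of tight edges of
potentials lying below the heights (`regCells`).

Regular subdivisions, upper bound: in a cell any two rows are joined by at most l - 1 steps through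
common columns, so each tightness test is the sign of a sum of at most 2l height differences
(`mem_regCells_of_sign_eq`). These are polynomially many functionals on a space of dimension lk, so
they have k^O(k) sign vectors (`ncard_range_signVector_le`). Lower bound: a permutation used as
heights in one row can be recovered from its subdivision, which gives k! of them.

All subdivisions, l ≥ 3: one explicit regular subdivision has at least ⌊k/4⌋² cells whose only
affine dependence is a 6-cycle (`isCircuitCell_hexGraph`). Faces of such a cell that contain the
6-cycle lie on the boundary, so no other cell contains it, and each of these cells can independently
be kept or triangulated (`two_pow_card_le_ncard_isPolySubdivision`). Since k^O(k) is 2^o(k²),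
regular subdivisions are negligible among the resulting 2^Ω(k²), and the non-regular ones have the
same lower order of growth. -/

/-! ### Cells of a point configuration and a combinatorial criterion for subdivisions. -/

section PointConfigurations

variable {ι E : Type*}

/-- The convex hull of the points of the configuration `v` labelled by `G`. -/
def cell [AddCommGroup E] [Module ℝ E] (v : ι → E) (G : Set ι) : Set E :=
  convexHull ℝ (v '' G)

theorem AffineMap.map_sum_smul [AddCommGroup E] [Module ℝ E] [Fintype ι] (f : E →ᵃ[ℝ] ℝ)
    {w : ι → ℝ} (hw : ∑ e, w e = 1) (v : ι → E) :
    f (∑ e, w e • v e) = ∑ e, w e * f (v e) := by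
  obtain ⟨a, hf⟩ : ∃ a, ∀ x, f x = f.linear x + a := ⟨f 0, congrFun f.decomp⟩
  simp only [hf, map_sum, map_smul, smul_eq_mul, mul_add, Finset.sum_add_distrib,
    ← Finset.sum_mul, hw, one_mul]

theorem AffineMap.sum_mul_eq_zero [AddCommGroup E] [Module ℝ E] [Fintype ι] (f : E →ᵃ[ℝ] ℝ)
    {c : ι → ℝ} {v : ι → E} (hc : ∑ e, c e = 0) (hcv : ∑ e, c e • v e = 0) :
    ∑ e, c e * f (v e) = 0 := by
  obtain ⟨a, hf⟩ : ∃ a, ∀ x, f x = f.linear x + a := ⟨f 0, congrFun f.decomp⟩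
  have h : f.linear (∑ e, c e • v e) = 0 := by rw [hcv, map_zero]
  simp only [map_sum, map_smul, smul_eq_mul] at h
  simp only [hf, mul_add, Finset.sum_add_distrib, ← Finset.sum_mul, hc, zero_mul, add_zero, h]

theorem mem_cell_iff [AddCommGroup E] [Module ℝ E] [Fintype ι] {v : ι → E} {G : Set ι} {x : E} :
    x ∈ cell v G ↔ ∃ w : ι → ℝ, (∀ e, 0 ≤ w e) ∧ (∀ e, e ∉ G → w e = 0) ∧ ∑ e, w e = 1 ∧
      ∑ e, w e • v e = x := by
  classical
  constructor
  · intro hx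
    refine convexHull_min (t := {x | ∃ w : ι → ℝ, (∀ e, 0 ≤ w e) ∧ (∀ e, e ∉ G → w e = 0) ∧
      ∑ e, w e = 1 ∧ ∑ e, w e • v e = x}) ?_ ?_ hx
    · rintro _ ⟨e, he, rfl⟩
      refine ⟨Pi.single e 1, fun e' => ?_, fun e' he' => ?_, by simp, ?_⟩
      · by_cases h : e' = e
        · subst h; simp
        · simp [h]
      · exact Pi.single_eq_of_ne (by rintro rfl; exact he' he) _
      · simp [Pi.single_apply]
    · rintro _ ⟨w, hw0, hwG, hw1, rfl⟩ _ ⟨w', hw0', hwG', hw1', rfl⟩ s t hs ht hst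
      refine ⟨fun e => s * w e + t * w' e, fun e => ?_, fun e he => ?_, ?_, ?_⟩
      · have := hw0 e; have := hw0' e; positivity
      · simp [hwG e he, hwG' e he]
      · simp [Finset.sum_add_distrib, ← Finset.mul_sum, hw1, hw1', hst]
      · simp [Finset.sum_add_distrib, Finset.smul_sum, add_smul, mul_smul]
  · rintro ⟨w, hw0, hwG, hw1, rfl⟩
    have h1 : ∑ e with e ∈ G, w e = ∑ e, w e :=
      Finset.sum_filter_of_ne fun e _ h => by_contra fun h' => h (hwG e h')
    have h2 : ∑ e with e ∈ G, w e • v e = ∑ e, w e • v e :=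
      Finset.sum_filter_of_ne fun e _ h => by_contra fun h' => h (by rw [hwG e h', zero_smul])
    rw [← h2]
    refine (convex_convexHull ℝ _).sum_mem (fun e _ => hw0 e) (h1.trans hw1) fun e he => ?_
    exact subset_convexHull ℝ _ ⟨e, (Finset.mem_filter.1 he).2, rfl⟩

/-- Every affine function that vanishes on the points labelled by `G` vanishes on the
configuration. -/
def Spans [AddCommGroup E] [Module ℝ E] (v : ι → E) (G : Set ι) : Prop :=
  ∀ f : E →ᵃ[ℝ] ℝ, (∀ e ∈ G, f (v e) = 0) → ∀ e, f (v e) = 0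

theorem AffineMap.eq_zero_of_mem_affineSpan [AddCommGroup E] [Module ℝ E] {f : E →ᵃ[ℝ] ℝ}
    {s : Set E} (hf : ∀ x ∈ s, f x = 0) {x : E} (hx : x ∈ affineSpan ℝ s) : f x = 0 := by
  have h1 : affineSpan ℝ s ≤ (affineSpan ℝ {(0 : ℝ)}).comap f := by
    rw [affineSpan_le]
    intro y hy
    simpa using hf y hy
  simpa using h1 hx

theorem exists_affineMap_of_notMem_affineSpan [AddCommGroup E] [Module ℝ E]
    {s : Set E} {x : E} (hx : x ∉ affineSpan ℝ s) :
    ∃ f : E →ᵃ[ℝ] ℝ, (∀ y ∈ s, f y = 0) ∧ f x ≠ 0 := by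
  rcases s.eq_empty_or_nonempty with rfl | ⟨p, hp⟩
  · exact ⟨AffineMap.const ℝ E 1, by simp, by simp⟩
  · have hp' := subset_affineSpan ℝ s hp
    have hxd : x - p ∉ (affineSpan ℝ s).direction := by
      intro h
      have := AffineSubspace.vadd_mem_of_mem_direction h hp'
      simp at this
      exact hx this
    obtain ⟨g, hg, hle⟩ := Submodule.exists_le_ker_of_notMem hxd
    refine ⟨g.toAffineMap - AffineMap.const ℝ E (g p), fun y hy => ?_, ?_⟩
    · have : y - p ∈ (affineSpan ℝ s).direction :=
        AffineSubspace.vsub_mem_direction (subset_affineSpan ℝ s hy) hp'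
      have := hle this
      simpa using this
    · simpa using hg

theorem spans_iff_affineSpan_eq [AddCommGroup E] [Module ℝ E] {v : ι → E} {G : Set ι} :
    Spans v G ↔ affineSpan ℝ (v '' G) = affineSpan ℝ (Set.range v) := by
  constructor
  · intro h
    refine le_antisymm (affineSpan_mono ℝ (Set.image_subset_range _ _)) ?_
    rw [affineSpan_le]
    rintro _ ⟨e, rfl⟩
    by_contra he
    obtain ⟨f, hf, hfe⟩ := exists_affineMap_of_notMem_affineSpan he
    exact hfe (h f (fun e' he' => hf _ ⟨e', he', rfl⟩) e)
  · intro h f hf e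
    refine AffineMap.eq_zero_of_mem_affineSpan (s := v '' G) (by rintro _ ⟨e, he, rfl⟩; exact hf e he) ?_
    rw [h]
    exact subset_affineSpan ℝ _ ⟨e, rfl⟩

/-- There is an affine function that is nonnegative on `G`, nonpositive on `G'`, and vanishes
exactly at the common points. -/
def Compat [AddCommGroup E] [Module ℝ E] (v : ι → E) (G G' : Set ι) : Prop :=
  ∃ f : E →ᵃ[ℝ] ℝ, (∀ e ∈ G, 0 ≤ f (v e)) ∧ (∀ e ∈ G', f (v e) ≤ 0) ∧
    (∀ e ∈ G, f (v e) = 0 → e ∈ G') ∧ ∀ e ∈ G', f (v e) = 0 → e ∈ G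

theorem Compat.symm [AddCommGroup E] [Module ℝ E] {v : ι → E} {G G' : Set ι}
    (h : Compat v G G') : Compat v G' G := by
  obtain ⟨f, h1, h2, h3, h4⟩ := h
  exact ⟨-f, by simpa using h2, by simpa using h1, by simpa using h4, by simpa using h3⟩

theorem Compat.refl [AddCommGroup E] [Module ℝ E] (v : ι → E) (G : Set ι) : Compat v G G :=
  ⟨0, by simp⟩

/-- A configuration in convex position: a cell contains no points but those that label it. -/
theorem mem_of_mem_cell [AddCommGroup E] [Module ℝ E] {v : ι → E} {P : Set E} (hv : Function.Injective v)
    (hP : P = convexHull ℝ (Set.range v)) (hext : P.extremePoints ℝ = Set.range v)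
    {G : Set ι} {e : ι} (he : v e ∈ cell v G) : e ∈ G := by
  have h1 : v e ∈ P.extremePoints ℝ := hext ▸ ⟨e, rfl⟩
  have h2 : v e ∈ (cell v G).extremePoints ℝ :=
    inter_extremePoints_subset_extremePoints_of_subset
      (hP ▸ convexHull_mono (Set.image_subset_range _ _)) ⟨he, h1⟩
  obtain ⟨e', he', h⟩ := extremePoints_convexHull_subset h2
  exact hv h ▸ he'

theorem mem_cell_iff_mem [AddCommGroup E] [Module ℝ E] {v : ι → E} {P : Set E} (hv : Function.Injective v)
    (hP : P = convexHull ℝ (Set.range v)) (hext : P.extremePoints ℝ = Set.range v)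
    {G : Set ι} {e : ι} : v e ∈ cell v G ↔ e ∈ G :=
  ⟨mem_of_mem_cell hv hP hext, fun h => subset_convexHull ℝ _ ⟨e, h, rfl⟩⟩

theorem cell_injective [AddCommGroup E] [Module ℝ E] {v : ι → E} {P : Set E} (hv : Function.Injective v)
    (hP : P = convexHull ℝ (Set.range v)) (hext : P.extremePoints ℝ = Set.range v) :
    Function.Injective (cell v) := by
  intro G G' h
  ext e
  rw [← mem_cell_iff_mem hv hP hext, h, mem_cell_iff_mem hv hP hext]

variable [NormedAddCommGroup E] [NormedSpace ℝ E] [FiniteDimensional ℝ E]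

/-- The separating function cuts out the common face: a convex combination of nonnegative values is
zero only if every label of positive weight is a zero, hence common. -/
theorem Compat.isExposed [Fintype ι] {v : ι → E} {G G' : Set ι} (h : Compat v G G') :
    IsExposed ℝ (cell v G) (cell v G ∩ cell v G') := by
  obtain ⟨f, h1, h2, h3, -⟩ := h
  have hnonneg : ∀ x ∈ cell v G, 0 ≤ f x := by
    intro x hx
    obtain ⟨w, hw0, hwG, hw1, rfl⟩ := mem_cell_iff.1 hx
    rw [f.map_sum_smul hw1]
    refine Finset.sum_nonneg fun e _ => ?_
    by_cases he : e ∈ G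
    · exact mul_nonneg (hw0 e) (h1 e he)
    · simp [hwG e he]
  have hmem : ∀ x ∈ cell v G, x ∈ cell v G' ↔ f x ≤ 0 := by
    intro x hx
    constructor
    · intro hx'
      obtain ⟨w, hw0, hwG, hw1, rfl⟩ := mem_cell_iff.1 hx'
      rw [f.map_sum_smul hw1]
      refine Finset.sum_nonpos fun e _ => ?_
      by_cases he : e ∈ G'
      · exact mul_nonpos_of_nonneg_of_nonpos (hw0 e) (h2 e he)
      · simp [hwG e he]
    · intro hfx
      obtain ⟨w, hw0, hwG, hw1, rfl⟩ := mem_cell_iff.1 hx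
      refine mem_cell_iff.2 ⟨w, hw0, fun e he => ?_, hw1, rfl⟩
      by_contra hwe
      have heG : e ∈ G := by_contra fun h => hwe (hwG e h)
      have hterm : ∀ e ∈ Finset.univ, 0 ≤ w e * f (v e) := by
        intro e _
        by_cases he : e ∈ G
        · exact mul_nonneg (hw0 e) (h1 e he)
        · simp [hwG e he]
      rw [f.map_sum_smul hw1] at hfx
      have := (Finset.sum_eq_zero_iff_of_nonneg hterm).1
        (le_antisymm hfx (Finset.sum_nonneg hterm)) e (Finset.mem_univ e)
      exact he (h3 e heG ((mul_eq_zero.1 this).resolve_left hwe))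
  rintro ⟨x₀, hx₀, hx₀'⟩
  have hdec : ∀ x, f x = f.linear x + f 0 := fun x => congrFun f.decomp x
  have hfx₀ : f x₀ = 0 := le_antisymm ((hmem x₀ hx₀).1 hx₀') (hnonneg x₀ hx₀)
  -- Exposed faces are sets of maximisers, whence the sign; the constant term of `f` plays no role.
  refine ⟨LinearMap.toContinuousLinearMap (-f.linear), ?_⟩
  ext x
  simp only [Set.mem_inter_iff, Set.mem_ofPred_eq, LinearMap.coe_toContinuousLinearMap',
    LinearMap.neg_apply, neg_le_neg_iff]
  refine and_congr_right fun hx => (hmem x hx).trans ⟨fun h y hy => ?_, fun h => ?_⟩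
  · have := hnonneg y hy
    rw [hdec] at this h
    linarith
  · have := h x₀ hx₀
    rw [hdec] at hfx₀ ⊢
    linarith

/-- A combinatorial criterion for a family of cells to form a polyhedral subdivision. -/
theorem isPolySubdivision_image_cell [Fintype ι] {v : ι → E} {P : Set E}
    (hP : P = convexHull ℝ (Set.range v)) (hext : P.extremePoints ℝ = Set.range v)
    {𝒢 : Set (Set ι)} (hspan : ∀ G ∈ 𝒢, Spans v G)
    (hcover : ∀ x ∈ P, ∃ G ∈ 𝒢, x ∈ cell v G)
    (hcompat : ∀ G ∈ 𝒢, ∀ G' ∈ 𝒢, Compat v G G') :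
    IsPolySubdivision P (cell v '' 𝒢) where
  isCell := by
    rintro _ ⟨G, hG, rfl⟩
    refine ⟨⟨v '' G, hext ▸ Set.image_subset_range _ _, rfl⟩, ?_⟩
    rw [cell, affineSpan_convexHull, hP, affineSpan_convexHull]
    exact spans_iff_affineSpan_eq.1 (hspan G hG)
  cover := by
    refine Set.Subset.antisymm ?_ fun x hx => ?_
    · rintro x ⟨_, ⟨G, hG, rfl⟩, hx⟩
      rw [hP]
      exact convexHull_mono (Set.image_subset_range _ _) hx
    · obtain ⟨G, hG, hx⟩ := hcover x hx
      exact ⟨_, ⟨G, hG, rfl⟩, hx⟩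
  inter_left := by
    rintro _ ⟨G, hG, rfl⟩ _ ⟨G', hG', rfl⟩
    exact (hcompat G hG G' hG').isExposed
  inter_right := by
    rintro _ ⟨G, hG, rfl⟩ _ ⟨G', hG', rfl⟩
    rw [Set.inter_comm]
    exact (hcompat G hG G' hG').symm.isExposed

end PointConfigurations

/-! ### Regular subdivisions as lower envelopes of heights. -/

section RegularSubdivisions

variable {ι E : Type*}

/-- The labels of the cells of the regular subdivision with heights `h`. -/
def regCells [AddCommGroup E] [Module ℝ E] (v : ι → E) (h : ι → ℝ) : Set (Set ι) :=
  {G | Spans v G ∧ ∃ φ : E →ᵃ[ℝ] ℝ, (∀ e, φ (v e) ≤ h e) ∧ ∀ e, e ∈ G ↔ φ (v e) = h e}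

theorem compat_of_mem_regCells [AddCommGroup E] [Module ℝ E] {v : ι → E} {h : ι → ℝ}
    {G G' : Set ι} (hG : G ∈ regCells v h) (hG' : G' ∈ regCells v h) : Compat v G G' := by
  obtain ⟨-, φ, hφ, hφG⟩ := hG
  obtain ⟨-, φ', hφ', hφG'⟩ := hG'
  refine ⟨φ - φ', fun e he => ?_, fun e he => ?_, fun e he h0 => ?_, fun e he h0 => ?_⟩ <;>
    simp only [AffineMap.coe_sub, Pi.sub_apply] at *
  · have := (hφG e).1 he; linarith [hφ' e]
  · have := (hφG' e).1 he; linarith [hφ e]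
  · rw [hφG']; have := (hφG e).1 he; linarith
  · rw [hφG]; have := (hφG' e).1 he; linarith

/-- If `G'` contains `G` and both are cells of a subdivision, they agree. -/
theorem Compat.eq_of_subset [AddCommGroup E] [Module ℝ E] {v : ι → E} {G G' : Set ι}
    (h : Compat v G G') (hG : Spans v G) (hsub : G ⊆ G') : G = G' := by
  obtain ⟨f, h1, h2, -, h4⟩ := h
  have h0 := hG f fun e he => le_antisymm (h2 e (hsub he)) (h1 e he)
  exact hsub.antisymm fun e he => h4 e he (h0 e)

theorem AffineMap.eq_zero_of_mem_convexHull_range [AddCommGroup E] [Module ℝ E] {v : ι → E}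
    {f : E →ᵃ[ℝ] ℝ} (hf : ∀ e, f (v e) = 0) {x : E} (hx : x ∈ convexHull ℝ (Set.range v)) :
    f x = 0 :=
  AffineMap.eq_zero_of_mem_affineSpan (by rintro _ ⟨e, rfl⟩; exact hf e)
    (convexHull_subset_affineSpan _ hx)

/-- An affine function below the heights can be raised, without decreasing its value at `x`, until
it supports a full-dimensional cell. -/
theorem exists_spans_of_le [AddCommGroup E] [Module ℝ E] [Fintype ι] {v : ι → E} {h : ι → ℝ}
    {x : E} (hx : x ∈ convexHull ℝ (Set.range v)) (φ : E →ᵃ[ℝ] ℝ) (hφ : ∀ e, φ (v e) ≤ h e) :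
    ∃ φ' : E →ᵃ[ℝ] ℝ, (∀ e, φ' (v e) ≤ h e) ∧ φ x ≤ φ' x ∧ Spans v {e | φ' (v e) = h e} := by
  classical
  -- Induction on the number of labels that are not tight.
  obtain ⟨n, hn⟩ : ∃ n, n = (Finset.univ.filter fun e => φ (v e) ≠ h e).card := ⟨_, rfl⟩
  induction n using Nat.strong_induction_on generalizing φ with
  | _ n ih =>
    by_cases hs : Spans v {e | φ (v e) = h e}
    · exact ⟨φ, hφ, le_rfl, hs⟩
    -- One of `g`, `-g` serves as direction, because a function that is nonpositive at all labels is
    -- nonpositive at `x`.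
    obtain ⟨g, hgT, hgx, e₀, hge₀⟩ : ∃ g : E →ᵃ[ℝ] ℝ, (∀ e, φ (v e) = h e → g (v e) = 0) ∧
        0 ≤ g x ∧ ∃ e, 0 < g (v e) := by
      have key : ∀ g : E →ᵃ[ℝ] ℝ, (∀ e, g (v e) ≤ 0) → g x ≤ 0 := by
        intro g hg
        obtain ⟨w, hw0, -, hw1, rfl⟩ := mem_cell_iff.1
          (show x ∈ cell v Set.univ by rwa [cell, Set.image_univ])
        rw [g.map_sum_smul hw1]
        exact Finset.sum_nonpos fun e _ => mul_nonpos_of_nonneg_of_nonpos (hw0 e) (hg e)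
      simp only [Spans, not_forall] at hs
      obtain ⟨g, hg, e, hge⟩ := hs
      have hg' : ∀ e, φ (v e) = h e → g (v e) = 0 := fun e he => hg e he
      by_cases hpos : 0 ≤ g x ∧ ∃ e, 0 < g (v e)
      · exact ⟨g, hg', hpos⟩
      refine ⟨-g, fun e he => by simp [hg' e he], ?_, ?_⟩
      · by_contra hneg
        simp only [AffineMap.coe_neg, Pi.neg_apply, Left.nonneg_neg_iff, not_le] at hneg
        refine hpos ⟨hneg.le, ?_⟩
        by_contra! hall
        exact absurd (key g hall) (not_le.2 hneg)
      · by_contra! hall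
        simp only [AffineMap.coe_neg, Pi.neg_apply, Left.neg_nonpos_iff] at hall
        have h1 := key (-g) (by simpa using hall)
        simp only [AffineMap.coe_neg, Pi.neg_apply, Left.neg_nonpos_iff] at h1
        exact hpos ⟨h1, e, lt_of_le_of_ne (hall e) (Ne.symm hge)⟩
    obtain ⟨e₁, he₁, hmin⟩ := Finset.exists_min_image (Finset.univ.filter fun e => 0 < g (v e))
      (fun e => (h e - φ (v e)) / g (v e)) ⟨e₀, by simpa using hge₀⟩
    simp only [Finset.mem_filter, Finset.mem_univ, true_and] at he₁ hmin
    -- Ratio test: the largest step along `g` that stays below the heights. It makes `e₁` tight and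
    -- keeps the tight labels tight.
    set t := (h e₁ - φ (v e₁)) / g (v e₁) with ht
    have ht0 : 0 ≤ t := div_nonneg (sub_nonneg.2 (hφ e₁)) he₁.le
    have hval : ∀ y, (φ + t • g) y = φ y + t * g y := fun y => by simp
    have hfeas : ∀ e, (φ + t • g) (v e) ≤ h e := by
      intro e
      rw [hval]
      rcases lt_or_ge 0 (g (v e)) with hpos | hneg
      · have := hmin e hpos
        rw [le_div_iff₀ hpos] at this
        linarith
      · nlinarith [hφ e]
    have hcard : (Finset.univ.filter fun e => (φ + t • g) (v e) ≠ h e).card < n := by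
      rw [hn]
      refine Finset.card_lt_card ⟨fun e he => ?_, fun hsub => ?_⟩
      · simp only [Finset.mem_filter, Finset.mem_univ, true_and, hval] at he ⊢
        intro he'
        exact he (by rw [he', hgT e he', mul_zero, add_zero])
      · have hmem : e₁ ∈ Finset.univ.filter fun e => φ (v e) ≠ h e := by
          simp only [Finset.mem_filter, Finset.mem_univ, true_and]
          exact fun h0 => he₁.ne' (hgT e₁ h0)
        have := hsub hmem
        simp only [Finset.mem_filter, Finset.mem_univ, true_and, hval] at this
        apply this
        rw [ht, div_mul_cancel₀ _ he₁.ne']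
        ring
    obtain ⟨φ', h1, h2, h3⟩ := ih _ hcard (φ + t • g) hfeas rfl
    refine ⟨φ', h1, le_trans ?_ h2, h3⟩
    rw [hval]
    nlinarith

/-- Among the finitely many cells, take one whose supporting function is largest at `x`. If `x` were
outside it, tilting this function by a functional that separates `x` from the cell, and raising the
result to a cell, would contradict maximality. -/
theorem exists_mem_regCells [NormedAddCommGroup E] [NormedSpace ℝ E] [FiniteDimensional ℝ E]
    [Fintype ι] [Nonempty ι] (v : ι → E) (h : ι → ℝ) {x : E}
    (hx : x ∈ convexHull ℝ (Set.range v)) : ∃ G ∈ regCells v h, x ∈ cell v G := by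
  classical
  have hex : ∀ G ∈ regCells v h, ∃ φ : E →ᵃ[ℝ] ℝ, (∀ e, φ (v e) ≤ h e) ∧
    ∀ e, e ∈ G ↔ φ (v e) = h e := fun G hG => hG.2
  choose! Φ hΦle hΦ using hex
  have hraise : ∀ φ : E →ᵃ[ℝ] ℝ, (∀ e, φ (v e) ≤ h e) → ∃ G ∈ regCells v h, φ x ≤ Φ G x := by
    intro φ hφ
    obtain ⟨φ', h1, h2, h3⟩ := exists_spans_of_le hx φ hφ
    have hG : {e | φ' (v e) = h e} ∈ regCells v h := ⟨h3, φ', h1, fun e => Iff.rfl⟩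
    refine ⟨_, hG, h2.trans (le_of_eq ?_)⟩
    have h4 := h3 (φ' - Φ {e | φ' (v e) = h e}) fun e he => by
      simp only [AffineMap.coe_sub, Pi.sub_apply]
      rw [(hΦ _ hG e).1 he, show φ' (v e) = h e from he, sub_self]
    have h5 := AffineMap.eq_zero_of_mem_convexHull_range h4 hx
    simpa [sub_eq_zero] using h5
  have hne : (regCells v h).Nonempty := by
    obtain ⟨e, he⟩ := Finite.exists_min h
    obtain ⟨G, hG, -⟩ := hraise (AffineMap.const ℝ E (h e)) (by simpa using he)
    exact ⟨G, hG⟩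
  obtain ⟨G, hG, hmax⟩ := Set.exists_max_image (regCells v h) (fun G => Φ G x)
    (Set.toFinite _) hne
  refine ⟨G, hG, ?_⟩
  by_contra hxG
  obtain ⟨l, u, hlt, hux⟩ := geometric_hahn_banach_closed_point (convex_convexHull ℝ (v '' G))
    (Set.Finite.isClosed_convexHull ℝ (Set.toFinite _)) hxG
  set g : E →ᵃ[ℝ] ℝ := l.toLinearMap.toAffineMap - AffineMap.const ℝ E u with hg
  have hgv : ∀ y, g y = l y - u := fun y => by simp [hg]
  -- The tilt does not raise the tight labels, and the slack ones tolerate a small tilt.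
  have hε : ∀ᶠ ε in 𝓝[>] (0 : ℝ), ∀ e, (Φ G + ε • g) (v e) ≤ h e := by
    rw [eventually_all]
    intro e
    have hval : ∀ ε : ℝ, (Φ G + ε • g) (v e) = Φ G (v e) + ε * g (v e) := fun ε => by simp
    by_cases he : e ∈ G
    · filter_upwards [self_mem_nhdsWithin] with ε hε
      have h1 : g (v e) ≤ 0 := by
        rw [hgv]
        exact sub_nonpos.2 (hlt _ (subset_convexHull ℝ _ ⟨e, he, rfl⟩)).le
      have h2 : ε * g (v e) ≤ 0 := mul_nonpos_of_nonneg_of_nonpos (le_of_lt hε) h1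
      rw [hval]
      linarith [hΦle G hG e]
    · have hlt : Φ G (v e) < h e :=
        lt_of_le_of_ne (hΦle G hG e) fun h0 => he ((hΦ G hG e).2 h0)
      have ht : Tendsto (fun ε : ℝ => Φ G (v e) + ε * g (v e)) (𝓝[>] 0)
          (𝓝 (Φ G (v e) + 0 * g (v e))) :=
        ((continuous_const.add (continuous_id.mul continuous_const)).tendsto 0).mono_left
          nhdsWithin_le_nhds
      rw [zero_mul, add_zero] at ht
      filter_upwards [ht.eventually_lt_const hlt] with ε hε
      rw [hval]
      exact hε.le
  obtain ⟨ε, hεle, hε0⟩ := (hε.and self_mem_nhdsWithin).exists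
  obtain ⟨G', hG', hle⟩ := hraise _ hεle
  have h1 := hmax G' hG'
  have h2 : 0 < ε * g x := mul_pos hε0 (by rw [hgv]; linarith)
  have h3 : (Φ G + ε • g) x = Φ G x + ε * g x := by simp
  rw [h3] at hle
  linarith

variable [NormedAddCommGroup E] [NormedSpace ℝ E] [Fintype ι] [Nonempty ι] {v : ι → E} {P : Set E}

theorem isRegularSubdivision_regCells [FiniteDimensional ℝ E] (hv : Function.Injective v)
    (hP : P = convexHull ℝ (Set.range v)) (hext : P.extremePoints ℝ = Set.range v) (h : ι → ℝ) :
    IsRegularSubdivision P (cell v '' regCells v h) := by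
  refine ⟨isPolySubdivision_image_cell hP hext (fun G hG => hG.1)
    (fun x hx => exists_mem_regCells v h (hP ▸ hx))
    fun G hG G' hG' => compat_of_mem_regCells hG hG', Function.extend v h 0, ?_⟩
  rintro _ ⟨G, ⟨-, φ, hφ, hφG⟩, rfl⟩
  refine ⟨φ, fun y hy => ?_⟩
  rw [hext] at hy
  obtain ⟨e, rfl⟩ := hy
  rw [hv.extend_apply, mem_cell_iff_mem hv hP hext]
  exact ⟨(hφG e).1, fun he => lt_of_le_of_ne (hφ e) fun h0 => he ((hφG e).2 h0)⟩

/-- Cells of `S` are tight sets by definition; the point is that no tight set is missing. The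
barycentre of a tight set lies in some cell of `S`. All its weights are positive, so compatibility
puts the tight set inside that cell, and nested compatible cells agree. -/
theorem IsRegularSubdivision.exists_eq_image_regCells
    (hP : P = convexHull ℝ (Set.range v)) (hext : P.extremePoints ℝ = Set.range v)
    {S : Set (Set E)} (hS : IsRegularSubdivision P S) :
    ∃ h : ι → ℝ, S = cell v '' regCells v h := by
  obtain ⟨hS, H, hH⟩ := hS
  have key : ∀ B ∈ S, {e | v e ∈ B} ∈ regCells v (H ∘ v) ∧ B = cell v {e | v e ∈ B} := by
    intro B hB
    obtain ⟨⟨V, hV, hBV⟩, hspan⟩ := hS.isCell B hB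
    have hB' : B = cell v {e | v e ∈ B} := by
      refine Set.Subset.antisymm ?_ ?_
      · conv_lhs => rw [hBV]
        refine convexHull_mono fun y hy => ?_
        obtain ⟨e, rfl⟩ := hext ▸ hV hy
        exact ⟨e, by rw [Set.mem_ofPred_eq, hBV]; exact subset_convexHull ℝ _ hy, rfl⟩
      · refine convexHull_min ?_ (hBV ▸ convex_convexHull ℝ V)
        rintro _ ⟨e, he, rfl⟩
        exact he
    obtain ⟨φ, hφ⟩ := hH B hB
    refine ⟨⟨?_, φ, fun e => ?_, fun e => ⟨fun he => ?_, fun he => ?_⟩⟩, hB'⟩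
    · rw [spans_iff_affineSpan_eq, ← affineSpan_convexHull (v '' _), ← cell, ← hB', hspan, hP,
        affineSpan_convexHull]
    · have := hφ (v e) (hext ▸ ⟨e, rfl⟩)
      by_cases he : v e ∈ B
      · exact (this.1 he).le
      · exact (this.2 he).le
    · exact (hφ (v e) (hext ▸ ⟨e, rfl⟩)).1 he
    · by_contra he'
      exact ((hφ (v e) (hext ▸ ⟨e, rfl⟩)).2 he').ne he
  refine ⟨H ∘ v, Set.Subset.antisymm (fun B hB => ⟨_, (key B hB).1, (key B hB).2.symm⟩) ?_⟩
  rintro _ ⟨G, hG, rfl⟩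
  have hGne : G.Nonempty := by
    by_contra hne
    rw [Set.not_nonempty_iff_eq_empty] at hne
    subst hne
    have := hG.1 (AffineMap.const ℝ E 1) (by simp) (Classical.arbitrary ι)
    simp at this
  classical
  have hcard : (0 : ℝ) < (Finset.univ.filter (· ∈ G)).card := by
    obtain ⟨e, he⟩ := hGne
    exact_mod_cast Finset.card_pos.2 ⟨e, by simpa using he⟩
  set w : ι → ℝ := fun e => if e ∈ G then ((Finset.univ.filter (· ∈ G)).card : ℝ)⁻¹ else 0 with hw
  have hw1 : ∑ e, w e = 1 := by
    simp only [hw, Finset.sum_ite, Finset.sum_const, nsmul_eq_mul, mul_zero, add_zero]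
    exact mul_inv_cancel₀ hcard.ne'
  have hx : ∑ e, w e • v e ∈ cell v G := by
    refine mem_cell_iff.2 ⟨w, fun e => ?_, fun e he => by simp [hw, he], hw1, rfl⟩
    simp only [hw]; split_ifs <;> positivity
  have hxP : ∑ e, w e • v e ∈ ⋃₀ S := by
    rw [hS.cover, hP]
    exact convexHull_mono (Set.image_subset_range _ _) hx
  obtain ⟨B, hB, hxB⟩ := hxP
  obtain ⟨hB1, hB2⟩ := key B hB
  suffices G = {e | v e ∈ B} by rw [this, ← hB2]; exact hB
  have hc := compat_of_mem_regCells hG hB1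
  refine hc.eq_of_subset hG.1 fun e he => ?_
  obtain ⟨f, h1, h2, h3, -⟩ := hc
  have hterm : ∀ e ∈ Finset.univ, 0 ≤ w e * f (v e) := by
    intro e _
    by_cases he : e ∈ G
    · exact mul_nonneg (by simp [hw, he]) (h1 e he)
    · simp [hw, he]
  have hle : ∑ e, w e * f (v e) ≤ 0 := by
    rw [← f.map_sum_smul hw1]
    rw [hB2] at hxB
    obtain ⟨w', hw0', hwG', hw1', hx'⟩ := mem_cell_iff.1 hxB
    rw [← hx', f.map_sum_smul hw1']
    refine Finset.sum_nonpos fun e _ => ?_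
    by_cases he : e ∈ {e | v e ∈ B}
    · exact mul_nonpos_of_nonneg_of_nonpos (hw0' e) (h2 e he)
    · simp [hwG' e he]
  have h0 := (Finset.sum_eq_zero_iff_of_nonneg hterm).1
    (le_antisymm hle (Finset.sum_nonneg hterm)) e (Finset.mem_univ e)
  have hwe : w e ≠ 0 := by simp [hw, he, hcard.ne']
  exact h3 e he ((mul_eq_zero.1 h0).resolve_left hwe)

/-- The regular subdivisions are those given by heights on the labels. -/
theorem setOf_isRegularSubdivision_eq [FiniteDimensional ℝ E] (hv : Function.Injective v)
    (hP : P = convexHull ℝ (Set.range v)) (hext : P.extremePoints ℝ = Set.range v) :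
    {S | IsRegularSubdivision P S} = Set.image (cell v) '' Set.range (regCells v) := by
  ext S
  constructor
  · intro hS
    obtain ⟨h, rfl⟩ := IsRegularSubdivision.exists_eq_image_regCells hP hext hS
    exact ⟨_, ⟨h, rfl⟩, rfl⟩
  · rintro ⟨_, ⟨h, rfl⟩, rfl⟩
    exact isRegularSubdivision_regCells hv hP hext h

theorem ncard_isRegularSubdivision [FiniteDimensional ℝ E] (hv : Function.Injective v)
    (hP : P = convexHull ℝ (Set.range v)) (hext : P.extremePoints ℝ = Set.range v) :
    {S | IsRegularSubdivision P S}.ncard = (Set.range (regCells v)).ncard := by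
  rw [setOf_isRegularSubdivision_eq hv hP hext]
  exact Set.ncard_image_of_injective _ (cell_injective hv hP hext).image_injective

end RegularSubdivisions

/-! ### Independent refinement of cells that carry a single affine dependence. -/

section CircuitRefinements

variable {ι E : Type*}

/-- A set `G` of labels whose points have, up to scaling, a single affine dependence `c`, and all
of whose faces containing the circuit of `c` lie on the boundary of the configuration. -/
structure IsCircuitCell [AddCommGroup E] [Module ℝ E] [Fintype ι] (v : ι → E) (G : Set ι)
    (c : ι → ℝ) : Prop where
  supp : ∀ e, c e ≠ 0 → e ∈ G
  sum_eq_zero : ∑ e, c e = 0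
  sum_smul_eq_zero : ∑ e, c e • v e = 0
  exists_pos : ∃ e, 0 < c e
  exists_extend : ∀ w : ι → ℝ, ∑ e, c e * w e = 0 → ∃ f : E →ᵃ[ℝ] ℝ, ∀ e ∈ G, f (v e) = w e
  nonneg : ∀ f : E →ᵃ[ℝ] ℝ, (∀ e, c e ≠ 0 → f (v e) = 0) → (∀ e ∈ G, 0 ≤ f (v e)) →
    ∀ e, 0 ≤ f (v e)

namespace IsCircuitCell

variable [AddCommGroup E] [Module ℝ E] [Fintype ι] {v : ι → E} {G G' : Set ι} {c : ι → ℝ}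

theorem spans (hc : IsCircuitCell v G c) : Spans v G := by
  intro f hf e
  refine le_antisymm ?_ (hc.nonneg f (fun e he => hf e (hc.supp e he)) (fun e he => (hf e he).ge) e)
  have := hc.nonneg (-f) (fun e he => by simp [hf e (hc.supp e he)])
    (fun e he => by simp [hf e he]) e
  simpa using this

theorem spans_diff (hc : IsCircuitCell v G c) {z : ι} (hz : c z ≠ 0) : Spans v (G \ {z}) := by
  classical
  intro f hf
  refine hc.spans f fun e he => ?_
  by_cases hez : e = z
  · subst hez
    have h1 := f.sum_mul_eq_zero hc.sum_eq_zero hc.sum_smul_eq_zero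
    rw [Finset.sum_eq_single e] at h1
    · exact (mul_eq_zero.1 h1).resolve_left hz
    · intro e' _ he'
      by_cases hce : c e' = 0
      · rw [hce, zero_mul]
      · rw [hf e' ⟨hc.supp e' hce, he'⟩, mul_zero]
    · simp
  · exact hf e ⟨he, hez⟩

/-- The separating function vanishes on the circuit, so `nonneg` makes it nonnegative everywhere.
Being nonpositive on the full-dimensional `G'`, it vanishes at all labels. -/
theorem eq_of_supp_subset (hc : IsCircuitCell v G c) (hG' : Spans v G') (h : Compat v G G')
    (hsub : ∀ e, c e ≠ 0 → e ∈ G') : G = G' := by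
  obtain ⟨f, h1, h2, h3, h4⟩ := h
  have h5 := hc.nonneg f (fun e he => le_antisymm (h2 e (hsub e he)) (h1 e (hc.supp e he))) h1
  have h6 := hG' f fun e he => le_antisymm (h2 e he) (h5 e)
  exact Set.Subset.antisymm (fun e he => h3 e he (h6 e)) fun e he => h4 e he (h6 e)

/-- Since `z` is not a common label, the value there is free and can be reset to make `w` orthogonal
to `c`. -/
theorem exists_extend_inter (hc : IsCircuitCell v G c) {z : ι} (hz : c z ≠ 0) (hzG' : z ∉ G')
    (w : ι → ℝ) : ∃ f : E →ᵃ[ℝ] ℝ, ∀ e ∈ G, e ∈ G' → f (v e) = w e := by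
  classical
  obtain ⟨f, hf⟩ := hc.exists_extend (w - Pi.single z ((∑ e, c e * w e) / c z)) (by
    simp only [Pi.sub_apply, mul_sub, Finset.sum_sub_distrib, Pi.single_apply, mul_ite, mul_zero,
      Finset.sum_ite_eq', Finset.mem_univ, if_true]
    rw [mul_div_cancel₀ _ hz, sub_self])
  refine ⟨f, fun e he he' => ?_⟩
  have : e ≠ z := by rintro rfl; exact hzG' he'
  simp [hf e he, this]

/-- Subtracting from the weights the largest multiple of `c` that keeps them nonnegative kills a
label of the positive part. -/
theorem exists_mem_cell_diff (hc : IsCircuitCell v G c) {x : E} (hx : x ∈ cell v G) :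
    ∃ z, 0 < c z ∧ x ∈ cell v (G \ {z}) := by
  classical
  obtain ⟨w, hw0, hwG, hw1, rfl⟩ := mem_cell_iff.1 hx
  obtain ⟨e₀, he₀⟩ := hc.exists_pos
  obtain ⟨z, hz, hmin⟩ := Finset.exists_min_image (Finset.univ.filter fun e => 0 < c e)
    (fun e => w e / c e) ⟨e₀, by simpa using he₀⟩
  simp only [Finset.mem_filter, Finset.mem_univ, true_and] at hz hmin
  have ht : 0 ≤ w z / c z := div_nonneg (hw0 z) hz.le
  refine ⟨z, hz, mem_cell_iff.2 ⟨fun e => w e - w z / c z * c e, fun e => ?_, fun e he => ?_, ?_, ?_⟩⟩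
  · rcases lt_or_ge 0 (c e) with hpos | hneg
    · have := hmin e hpos
      rw [le_div_iff₀ hpos] at this
      linarith
    · have := hw0 e
      nlinarith
  · by_cases hez : e = z
    · subst hez
      simp only [div_mul_cancel₀ _ hz.ne', sub_self]
    · have heG : e ∉ G := fun h => he ⟨h, hez⟩
      have hce : c e = 0 := by_contra fun h => heG (hc.supp e h)
      simp [hwG e heG, hce]
  · simp [Finset.sum_sub_distrib, ← Finset.mul_sum, hw1, hc.sum_eq_zero]
  · simp only [sub_smul, mul_smul, Finset.sum_sub_distrib, ← Finset.smul_sum, hc.sum_smul_eq_zero,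
      smul_zero, sub_zero]

theorem compat_diff (hc : IsCircuitCell v G c) {z z' : ι} (hz : 0 < c z) (hz' : 0 < c z') :
    Compat v (G \ {z}) (G \ {z'}) := by
  classical
  by_cases hzz : z = z'
  · subst hzz
    exact Compat.refl v _
  -- These values are orthogonal to `c`; `f` separates the two simplices along their common facet.
  obtain ⟨f, hf⟩ := hc.exists_extend (Pi.single z' (1 / c z') - Pi.single z (1 / c z)) (by
    simp only [Pi.sub_apply, mul_sub, Finset.sum_sub_distrib, Pi.single_apply, mul_ite, mul_zero,
      Finset.sum_ite_eq', Finset.mem_univ, if_true]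
    rw [mul_div_cancel₀ _ hz'.ne', mul_div_cancel₀ _ hz.ne', sub_self])
  have hpos : 0 < 1 / c z := one_div_pos.2 hz
  have hpos' : 0 < 1 / c z' := one_div_pos.2 hz'
  have h1 : ∀ e ∈ G, e ≠ z → e ≠ z' → f (v e) = 0 := fun e he h h' => by simp [hf e he, h, h']
  have h2 : f (v z') = 1 / c z' := by
    simp [hf z' (hc.supp _ hz'.ne'), Ne.symm hzz]
  have h3 : f (v z) = -(1 / c z) := by
    simp [hf z (hc.supp _ hz.ne'), hzz]
  refine ⟨f, ?_, ?_, ?_, ?_⟩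
  · rintro e ⟨he, hez⟩
    by_cases hez' : e = z'
    · rw [hez', h2]; exact hpos'.le
    · exact (h1 e he hez hez').ge
  · rintro e ⟨he, hez'⟩
    by_cases hez : e = z
    · rw [hez, h3]; linarith
    · exact (h1 e he hez hez').le
  · rintro e ⟨he, -⟩ h0
    refine ⟨he, ?_⟩
    rintro rfl
    rw [h2] at h0
    exact hpos'.ne' h0
  · rintro e ⟨he, -⟩ h0
    refine ⟨he, ?_⟩
    rintro rfl
    rw [h3] at h0
    linarith

end IsCircuitCell

/-- If the common points are affinely independent, any subsets of two compatible cells are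
compatible. -/
theorem Compat.mono_of_extend [AddCommGroup E] [Module ℝ E] [Finite ι] {v : ι → E}
    {G G' G₁ G₁' : Set ι} (h : Compat v G G')
    (hext : ∀ w : ι → ℝ, ∃ f : E →ᵃ[ℝ] ℝ, ∀ e ∈ G, e ∈ G' → f (v e) = w e)
    (h₁ : G₁ ⊆ G) (h₁' : G₁' ⊆ G') : Compat v G₁ G₁' := by
  classical
  obtain ⟨f, h1, h2, h3, h4⟩ := h
  -- At common points `f` vanishes and a small multiple of `g` decides the sign as needed; elsewhere
  -- on the cells `f` dominates.
  obtain ⟨g, hg⟩ := hext fun e => (if e ∈ G₁ then 1 else 0) - (if e ∈ G₁' then 1 else 0)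
  have hval : ∀ (ε : ℝ) e, (f + ε • g) (v e) = f (v e) + ε * g (v e) := fun ε e => by simp
  have ht : ∀ e, Tendsto (fun ε : ℝ => (f + ε • g) (v e)) (𝓝[>] 0) (𝓝 (f (v e))) := by
    intro e
    have : Tendsto (fun ε : ℝ => f (v e) + ε * g (v e)) (𝓝[>] 0) (𝓝 (f (v e) + 0 * g (v e))) :=
      ((continuous_const.add (continuous_id.mul continuous_const)).tendsto 0).mono_left
        nhdsWithin_le_nhds
    simpa only [hval, zero_mul, add_zero] using this
  have hpos : ∀ᶠ ε in 𝓝[>] (0 : ℝ), ∀ e, 0 < f (v e) → 0 < (f + ε • g) (v e) := by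
    rw [eventually_all]
    intro e
    by_cases he : 0 < f (v e)
    · filter_upwards [(ht e).eventually_const_lt he] with ε hε using fun _ => hε
    · exact Eventually.of_forall fun _ h => absurd h he
  have hneg : ∀ᶠ ε in 𝓝[>] (0 : ℝ), ∀ e, f (v e) < 0 → (f + ε • g) (v e) < 0 := by
    rw [eventually_all]
    intro e
    by_cases he : f (v e) < 0
    · filter_upwards [(ht e).eventually_lt_const he] with ε hε using fun _ => hε
    · exact Eventually.of_forall fun _ h => absurd h he
  obtain ⟨ε, ⟨hε1, hε2⟩, hε0⟩ := ((hpos.and hneg).and self_mem_nhdsWithin).exists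
  have hε : (0 : ℝ) < ε := hε0
  have hcommon : ∀ e ∈ G, e ∈ G' →
      (f + ε • g) (v e) = ε * ((if e ∈ G₁ then 1 else 0) - (if e ∈ G₁' then 1 else 0)) := by
    intro e he he'
    rw [hval, le_antisymm (h2 e he') (h1 e he), zero_add, hg e he he']
  refine ⟨f + ε • g, fun e he => ?_, fun e he => ?_, fun e he h0 => ?_, fun e he h0 => ?_⟩
  · by_cases he' : e ∈ G'
    · rw [hcommon e (h₁ he) he', if_pos he]
      split_ifs <;> simp [hε.le]
    · exact (hε1 e (lt_of_le_of_ne (h1 e (h₁ he)) fun h => he' (h3 e (h₁ he) h.symm))).le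
  · by_cases he' : e ∈ G
    · rw [hcommon e he' (h₁' he), if_pos he]
      split_ifs <;> simp [hε.le]
    · exact (hε2 e (lt_of_le_of_ne (h2 e (h₁' he)) fun h => he' (h4 e (h₁' he) h))).le
  · by_cases he' : e ∈ G'
    · rw [hcommon e (h₁ he) he', if_pos he] at h0
      by_contra hne
      simp [hne, hε.ne'] at h0
    · exact absurd h0
        (hε1 e (lt_of_le_of_ne (h1 e (h₁ he)) fun h => he' (h3 e (h₁ he) h.symm))).ne'
  · by_cases he' : e ∈ G
    · rw [hcommon e he' (h₁' he), if_pos he] at h0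
      by_contra hne
      simp [hne, hε.ne'] at h0
    · exact absurd h0
        (hε2 e (lt_of_le_of_ne (h2 e (h₁' he)) fun h => he' (h4 e (h₁' he) h))).ne

/-- The family obtained from the regular subdivision with heights `h` by triangulating the circuit
in each cell `Γ a` with `a ∈ T`. -/
def refinedCells [AddCommGroup E] [Module ℝ E] {κ : Type*} (v : ι → E) (h : ι → ℝ)
    (Γ : κ → Set ι) (c : κ → ι → ℝ) (T : Set κ) : Set (Set ι) :=
  {G | G ∈ regCells v h ∧ G ∉ Γ '' T} ∪ {G | ∃ a ∈ T, ∃ z, 0 < c a z ∧ G = Γ a \ {z}}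

section Refined

variable {κ : Type*} {v : ι → E} {h : ι → ℝ} {Γ : κ → Set ι} {c : κ → ι → ℝ} {T : Set κ}

/-- A different cell misses a label of the circuit, so the common points are affinely independent.
This is why refinements of different cells do not interfere. -/
theorem compat_of_ne [AddCommGroup E] [Module ℝ E] [Fintype ι] {G G' G₁ G₁' : Set ι} {c : ι → ℝ}
    (hc : IsCircuitCell v G c) (hG : G ∈ regCells v h) (hG' : G' ∈ regCells v h) (hne : G ≠ G')
    (h₁ : G₁ ⊆ G) (h₁' : G₁' ⊆ G') : Compat v G₁ G₁' := by
  have hcompat := compat_of_mem_regCells hG hG'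
  have hz : ∃ z, c z ≠ 0 ∧ z ∉ G' := by
    by_contra! hall
    exact hne (hc.eq_of_supp_subset hG'.1 hcompat hall)
  obtain ⟨z, hz, hzG'⟩ := hz
  exact hcompat.mono_of_extend (hc.exists_extend_inter hz hzG') h₁ h₁'

theorem compat_of_mem_refinedCells [AddCommGroup E] [Module ℝ E] [Fintype ι]
    (hinj : Function.Injective Γ) (hΓ : ∀ a, Γ a ∈ regCells v h) (hc : ∀ a, IsCircuitCell v (Γ a) (c a)) {G G' : Set ι}
    (hG : G ∈ refinedCells v h Γ c T) (hG' : G' ∈ refinedCells v h Γ c T) : Compat v G G' := by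
  rcases hG with ⟨hG, hGT⟩ | ⟨a, ha, z, hz, rfl⟩
  · rcases hG' with ⟨hG', -⟩ | ⟨a', ha', z', hz', rfl⟩
    · exact compat_of_mem_regCells hG hG'
    · refine (compat_of_ne (hc a') (hΓ a') hG ?_ Set.sdiff_subset subset_rfl).symm
      rintro rfl
      exact hGT ⟨a', ha', rfl⟩
  · rcases hG' with ⟨hG', hGT'⟩ | ⟨a', ha', z', hz', rfl⟩
    · refine compat_of_ne (hc a) (hΓ a) hG' ?_ Set.sdiff_subset subset_rfl
      rintro rfl
      exact hGT' ⟨a, ha, rfl⟩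
    · by_cases haa : a = a'
      · subst haa
        exact (hc a).compat_diff hz hz'
      · exact compat_of_ne (hc a) (hΓ a) (hΓ a') (hinj.ne haa) Set.sdiff_subset Set.sdiff_subset

theorem refinedCells_injective [AddCommGroup E] [Module ℝ E] [Fintype ι]
    (hinj : Function.Injective Γ) (hΓ : ∀ a, Γ a ∈ regCells v h)
    (hc : ∀ a, IsCircuitCell v (Γ a) (c a)) : Function.Injective (refinedCells v h Γ c) := by
  -- `T` is read off from the circuit cells that survive.
  have key : ∀ T a, Γ a ∈ refinedCells v h Γ c T ↔ a ∉ T := by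
    intro T a
    constructor
    · rintro (⟨-, hT⟩ | ⟨a', -, z, hz, heq⟩) haT
      · exact hT ⟨a, haT, rfl⟩
      · have h1 : Γ a = Γ a' := (compat_of_mem_regCells (hΓ a) (hΓ a')).eq_of_subset (hΓ a).1
          (heq ▸ Set.sdiff_subset)
        have h2 : z ∈ Γ a := h1 ▸ (hc a').supp z hz.ne'
        rw [heq] at h2
        exact h2.2 rfl
    · intro haT
      refine Or.inl ⟨hΓ a, ?_⟩
      rintro ⟨a', ha', heq⟩
      exact haT (hinj heq ▸ ha')
  intro T T' hTT
  ext a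
  rw [← not_iff_not, ← key T, ← key T', hTT]

theorem isPolySubdivision_refinedCells [NormedAddCommGroup E] [NormedSpace ℝ E]
    [FiniteDimensional ℝ E] [Fintype ι] [Nonempty ι] {P : Set E}
    (hP : P = convexHull ℝ (Set.range v)) (hext : P.extremePoints ℝ = Set.range v)
    (hinj : Function.Injective Γ) (hΓ : ∀ a, Γ a ∈ regCells v h)
    (hc : ∀ a, IsCircuitCell v (Γ a) (c a)) (T : Set κ) :
    IsPolySubdivision P (cell v '' refinedCells v h Γ c T) := by
  refine isPolySubdivision_image_cell hP hext ?_ ?_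
    fun G hG G' hG' => compat_of_mem_refinedCells hinj hΓ hc hG hG'
  · rintro G (⟨hG, -⟩ | ⟨a, -, z, hz, rfl⟩)
    · exact hG.1
    · exact (hc a).spans_diff hz.ne'
  · intro x hx
    obtain ⟨G, hG, hxG⟩ := exists_mem_regCells v h (hP ▸ hx)
    by_cases hGT : G ∈ Γ '' T
    · obtain ⟨a, ha, rfl⟩ := hGT
      obtain ⟨z, hz, hxz⟩ := (hc a).exists_mem_cell_diff hxG
      exact ⟨_, Or.inr ⟨a, ha, z, hz, rfl⟩, hxz⟩
    · exact ⟨G, Or.inl ⟨hG, hGT⟩, hxG⟩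

/-- A regular subdivision with `n` circuit cells has at least `2 ^ n` refinements. -/
theorem two_pow_card_le_ncard_isPolySubdivision [NormedAddCommGroup E] [NormedSpace ℝ E]
    [FiniteDimensional ℝ E] [Fintype ι] [Nonempty ι] {P : Set E} (hv : Function.Injective v)
    (hP : P = convexHull ℝ (Set.range v)) (hext : P.extremePoints ℝ = Set.range v) [Fintype κ]
    (hinj : Function.Injective Γ) (hΓ : ∀ a, Γ a ∈ regCells v h)
    (hc : ∀ a, IsCircuitCell v (Γ a) (c a)) :
    2 ^ Fintype.card κ ≤ {S | IsPolySubdivision P S}.ncard := by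
  have h1 : Function.Injective fun T : Set κ => cell v '' refinedCells v h Γ c T :=
    (cell_injective hv hP hext).image_injective.comp (refinedCells_injective hinj hΓ hc)
  have h2 : (Set.range fun T : Set κ => cell v '' refinedCells v h Γ c T).ncard
      = 2 ^ Fintype.card κ := by
    rw [← Set.image_univ, Set.ncard_image_of_injective _ h1, Set.ncard_univ,
      Nat.card_eq_fintype_card, Fintype.card_set]
  rw [← h2]
  refine Set.ncard_le_ncard ?_ (finite_isPolySubdivision (hext ▸ Set.finite_range v))
  rintro _ ⟨T, rfl⟩
  exact isPolySubdivision_refinedCells hP hext hinj hΓ hc T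

end Refined

end CircuitRefinements

/-! ### Counting sign vectors of a family of linear functionals. -/

section SignVectors

/-- The sign vector of `x` with respect to finitely many linear functionals. -/
noncomputable def signVector {W κ : Type*} [AddCommGroup W] [Module ℝ W]
    (L : κ → Module.Dual ℝ W) (x : W) : κ → SignType :=
  fun i => SignType.sign (L i x)

/-- `N` linear functionals on a `d`-dimensional space have at most `(2N+1)^d` sign vectors. -/
theorem ncard_range_signVector_le (N : ℕ) : ∀ {W : Type} [AddCommGroup W] [Module ℝ W]
    [FiniteDimensional ℝ W] (L : Fin N → Module.Dual ℝ W),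
    (Set.range (signVector L)).ncard ≤ (2 * N + 1) ^ Module.finrank ℝ W := by
  classical
  induction N with
  | zero =>
    intro W _ _ _ L
    calc _ ≤ 1 := Set.ncard_le_one_of_subsingleton _
      _ ≤ _ := by simp
  | succ N ih =>
    intro W _ _ _ L
    set A := Set.range (signVector fun i : Fin N => L i.castSucc) with hA
    set K := LinearMap.ker (L (Fin.last N))
    set Z := Set.range (signVector fun i : Fin N => (L i.castSucc).comp K.subtype) with hZ
    have hsnoc : ∀ x, signVector L x = Fin.snoc (α := fun _ => SignType)
        (signVector (fun i : Fin N => L i.castSucc) x) (SignType.sign (L (Fin.last N) x)) := by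
      intro x
      ext i
      refine Fin.lastCases ?_ (fun j => ?_) i
      · simp [signVector]
      · simp [signVector]
    have hAle := ih fun i : Fin N => L i.castSucc
    by_cases h0 : L (Fin.last N) = 0
    · have hsub : Set.range (signVector L) ⊆
          (fun σ => Fin.snoc (α := fun _ => SignType) σ 0) '' A := by
        rintro _ ⟨x, rfl⟩
        exact ⟨_, ⟨x, rfl⟩, by rw [hsnoc, h0]; simp⟩
      calc _ ≤ _ := Set.ncard_le_ncard hsub (Set.toFinite _)
        _ ≤ A.ncard := Set.ncard_image_le (Set.toFinite _)
        _ ≤ _ := hAle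
        _ ≤ _ := Nat.pow_le_pow_left (by lia) _
    · have hrank : Module.finrank ℝ K + 1 = Module.finrank ℝ W :=
        Module.Dual.finrank_ker_add_one_of_ne_zero h0
      have hZle : Z.ncard ≤ _ := ih fun i : Fin N => (L i.castSucc).comp K.subtype
      -- If a pattern occurs on both sides of the last hyperplane, a positive combination of the two
      -- witnesses has the same pattern and lies on the hyperplane.
      have hunique : ∀ x y, signVector (fun i : Fin N => L i.castSucc) x =
          signVector (fun i : Fin N => L i.castSucc) y → 0 < L (Fin.last N) x →
          L (Fin.last N) y < 0 → signVector (fun i : Fin N => L i.castSucc) x ∈ Z := by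
        intro x y hxy hx hy
        set p := L (Fin.last N) x
        set q := L (Fin.last N) y
        refine ⟨⟨(-q) • x + p • y, ?_⟩, ?_⟩
        · simp only [K, LinearMap.mem_ker, map_add, map_smul, smul_eq_mul]
          ring
        · ext i
          have hi := congrFun hxy i
          simp only [signVector] at hi ⊢
          simp only [LinearMap.comp_apply, Submodule.subtype_apply, map_add, map_smul, smul_eq_mul]
          rcases lt_trichotomy (L i.castSucc x) 0 with h | h | h
          · rw [sign_neg h] at hi ⊢
            have hyi := sign_eq_neg_one_iff.1 hi.symm
            exact sign_neg (by nlinarith)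
          · rw [h, sign_zero] at hi
            have hyi := sign_eq_zero_iff.1 hi.symm
            rw [h, hyi]
            simp
          · rw [sign_pos h] at hi ⊢
            have hyi := sign_eq_one_iff.1 hi.symm
            exact sign_pos (by nlinarith)
      have hex : ∀ σ, ∃ s : SignType, (σ ∈ Z → s = 0) ∧ (σ ∉ Z → ∀ x,
          signVector (fun i : Fin N => L i.castSucc) x = σ →
            SignType.sign (L (Fin.last N) x) = s) := by
        intro σ
        by_cases hσ : σ ∈ Z
        · exact ⟨0, fun _ => rfl, fun h => absurd hσ h⟩
        by_cases hσA : ∃ x, signVector (fun i : Fin N => L i.castSucc) x = σ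
        · obtain ⟨x, hx⟩ := hσA
          refine ⟨SignType.sign (L (Fin.last N) x), fun h => absurd h hσ, fun _ y hy => ?_⟩
          have hne : ∀ z, signVector (fun i : Fin N => L i.castSucc) z = σ →
              L (Fin.last N) z ≠ 0 := by
            intro z hz hz0
            exact hσ ⟨⟨z, hz0⟩, hz⟩
          rcases (hne x hx).lt_or_gt with h | h <;> rcases (hne y hy).lt_or_gt with h' | h'
          · rw [sign_neg h, sign_neg h']
          · exact absurd (hy ▸ hunique y x (hy.trans hx.symm) h' h) hσ
          · exact absurd (hx ▸ hunique x y (hx.trans hy.symm) h h') hσ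
          · rw [sign_pos h, sign_pos h']
        · exact ⟨0, fun _ => rfl, fun _ x hx => absurd ⟨x, hx⟩ hσA⟩
      choose s hs0 hs using hex
      -- A pattern that meets the hyperplane extends in at most three ways, any other in one, so the
      -- count is at most `|A| + 2|Z|`.
      have hsub : Set.range (signVector L) ⊆
          (fun σ => Fin.snoc (α := fun _ => SignType) σ (s σ)) '' A ∪
          ((fun σ => Fin.snoc (α := fun _ => SignType) σ 1) '' Z ∪
           (fun σ => Fin.snoc (α := fun _ => SignType) σ (-1)) '' Z) := by
        rintro _ ⟨x, rfl⟩
        rw [hsnoc]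
        set σ := signVector (fun i : Fin N => L i.castSucc) x with hσ
        by_cases hσZ : σ ∈ Z
        · rcases lt_trichotomy (L (Fin.last N) x) 0 with h | h | h
          · exact Or.inr (Or.inr ⟨σ, hσZ, by rw [sign_neg h]⟩)
          · exact Or.inl ⟨σ, ⟨x, rfl⟩, by simp only [hs0 σ hσZ, h, sign_zero]⟩
          · exact Or.inr (Or.inl ⟨σ, hσZ, by rw [sign_pos h]⟩)
        · exact Or.inl ⟨σ, ⟨x, rfl⟩, by simp only [hs σ hσZ x rfl]⟩
      have h1 : (Set.range (signVector L)).ncard ≤ A.ncard + (Z.ncard + Z.ncard) := by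
        refine (Set.ncard_le_ncard hsub (Set.toFinite _)).trans ?_
        refine (Set.ncard_union_le _ _).trans (Nat.add_le_add (Set.ncard_image_le (Set.toFinite _)) ?_)
        exact (Set.ncard_union_le _ _).trans (Nat.add_le_add (Set.ncard_image_le (Set.toFinite _))
          (Set.ncard_image_le (Set.toFinite _)))
      rw [← hrank] at hAle ⊢
      set d := Module.finrank ℝ K
      -- The sum of the two inductive bounds is `(2N+1)^(d+1) + 2(2N+1)^d = (2N+3)(2N+1)^d`.
      have h2 : (2 * N + 1) ^ d ≤ (2 * (N + 1) + 1) ^ d := Nat.pow_le_pow_left (by lia) _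
      rw [pow_succ] at hAle ⊢
      nlinarith

end SignVectors

/-! ### Vertices of the product of simplices, and affine functions as potentials. -/

section SimplexProduct

theorem extremePoints_stdSimplex (n : ℕ) :
    (stdSimplex ℝ (Fin n)).extremePoints ℝ = Set.range fun i : Fin n => Pi.single i (1 : ℝ) := by
  refine Set.Subset.antisymm ?_ ?_
  · rw [← convexHull_rangle_single_eq_stdSimplex]
    exact extremePoints_convexHull_subset
  · rintro _ ⟨i, rfl⟩
    rw [mem_extremePoints_iff_left]
    refine ⟨single_mem_stdSimplex ℝ i, ?_⟩
    rintro x ⟨hx0, hx1⟩ y ⟨hy0, -⟩ ⟨s, t, hs, ht, -, hxy⟩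
    have h0 : ∀ j, j ≠ i → x j = 0 := by
      intro j hj
      have h1 := congrFun hxy j
      simp only [Pi.add_apply, Pi.smul_apply, smul_eq_mul, Pi.single_eq_of_ne hj] at h1
      have h2 := mul_nonneg ht.le (hy0 j)
      have h3 := mul_nonneg hs.le (hx0 j)
      exact (mul_eq_zero.1 (le_antisymm (by linarith) h3)).resolve_left hs.ne'
    ext j
    by_cases hj : j = i
    · subst hj
      rw [Finset.sum_eq_single j (fun j' _ h => h0 j' h) (by simp)] at hx1
      simp [hx1]
    · simp [h0 j hj, hj]

/-- The vertex `(e_i, e_j)` of the product of simplices. -/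
def prodVertex (l k : ℕ) (e : Fin l × Fin k) : (Fin l → ℝ) × (Fin k → ℝ) :=
  (Pi.single e.1 1, Pi.single e.2 1)

theorem prodVertex_injective (l k : ℕ) : Function.Injective (prodVertex l k) := by
  have key : ∀ {n : ℕ} {i j : Fin n},
      (Pi.single i 1 : Fin n → ℝ) = Pi.single j 1 → i = j := by
    intro n i j h
    by_contra hij
    simpa [hij] using congrFun h i
  intro e e' h
  simp only [prodVertex, Prod.mk.injEq] at h
  exact Prod.ext (key h.1) (key h.2)

theorem range_prodVertex (l k : ℕ) : Set.range (prodVertex l k) =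
    (Set.range fun i : Fin l => Pi.single i (1 : ℝ)) ×ˢ
      Set.range fun j : Fin k => Pi.single j (1 : ℝ) := by
  rw [Set.prod_range_range_eq]
  rfl

theorem simplexProd_eq_convexHull (l k : ℕ) :
    simplexProd l k = convexHull ℝ (Set.range (prodVertex l k)) := by
  rw [range_prodVertex, convexHull_prod, convexHull_rangle_single_eq_stdSimplex,
    convexHull_rangle_single_eq_stdSimplex, simplexProd]

theorem extremePoints_simplexProd (l k : ℕ) :
    (simplexProd l k).extremePoints ℝ = Set.range (prodVertex l k) := by
  rw [range_prodVertex, simplexProd, extremePoints_prod, extremePoints_stdSimplex,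
    extremePoints_stdSimplex]

theorem numRegularSubdivisions_eq (l k : ℕ) [Nonempty (Fin l × Fin k)] :
    numRegularSubdivisions l k = (Set.range (regCells (prodVertex l k))).ncard :=
  ncard_isRegularSubdivision (prodVertex_injective l k) (simplexProd_eq_convexHull l k)
    (extremePoints_simplexProd l k)

/-- The affine function with value `a i + b j` at the vertex `(e_i, e_j)`. -/
noncomputable def potential {l k : ℕ} (a : Fin l → ℝ) (b : Fin k → ℝ) :
    (Fin l → ℝ) × (Fin k → ℝ) →ᵃ[ℝ] ℝ :=
  (LinearMap.coprod (∑ i, a i • LinearMap.proj i) (∑ j, b j • LinearMap.proj j)).toAffineMap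

@[simp]
theorem potential_prodVertex {l k : ℕ} (a : Fin l → ℝ) (b : Fin k → ℝ) (e : Fin l × Fin k) :
    potential a b (prodVertex l k e) = a e.1 + b e.2 := by
  simp [potential, prodVertex, Pi.single_apply]

theorem exists_potential {l k : ℕ} (φ : (Fin l → ℝ) × (Fin k → ℝ) →ᵃ[ℝ] ℝ) :
    ∃ (a : Fin l → ℝ) (b : Fin k → ℝ), ∀ e, φ (prodVertex l k e) = a e.1 + b e.2 := by
  -- The constant term is absorbed into the row potential.
  refine ⟨fun i => φ.linear (Pi.single i 1, 0) + φ 0, fun j => φ.linear (0, Pi.single j 1),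
    fun e => ?_⟩
  have h1 : φ (prodVertex l k e) = φ.linear (prodVertex l k e) + φ 0 := congrFun φ.decomp _
  have h2 : prodVertex l k e = (Pi.single e.1 1, 0) + (0, Pi.single e.2 1) := by
    simp [prodVertex]
  rw [h1, h2, map_add]
  ring

theorem spans_prodVertex_iff {l k : ℕ} {G : Set (Fin l × Fin k)} :
    Spans (prodVertex l k) G ↔ ∀ (a : Fin l → ℝ) (b : Fin k → ℝ),
      (∀ e ∈ G, a e.1 + b e.2 = 0) → ∀ e : Fin l × Fin k, a e.1 + b e.2 = 0 := by
  constructor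
  · intro h a b hab e
    simpa using h (potential a b) (by simpa using hab) e
  · intro h f hf e
    obtain ⟨a, b, hab⟩ := exists_potential f
    simp only [hab] at hf ⊢
    exact h a b hf e

theorem mem_regCells_prodVertex_iff {l k : ℕ} {h : Fin l × Fin k → ℝ}
    {G : Set (Fin l × Fin k)} : G ∈ regCells (prodVertex l k) h ↔
      Spans (prodVertex l k) G ∧ ∃ (a : Fin l → ℝ) (b : Fin k → ℝ),
        (∀ e, a e.1 + b e.2 ≤ h e) ∧ ∀ e, e ∈ G ↔ a e.1 + b e.2 = h e := by
  refine and_congr_right fun _ => ⟨?_, ?_⟩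
  · rintro ⟨φ, h1, h2⟩
    obtain ⟨a, b, hab⟩ := exists_potential φ
    simp only [hab] at h1 h2
    exact ⟨a, b, h1, h2⟩
  · rintro ⟨a, b, h1, h2⟩
    exact ⟨potential a b, by simpa using h1, by simpa using h2⟩

end SimplexProduct

/-! ### Upper bound for regular subdivisions. -/

section UpperBound

open scoped Pointwise

/-- The rows, joined when they are tight in a common column. -/
def rowGraph {l k : ℕ} (G : Set (Fin l × Fin k)) : SimpleGraph (Fin l) where
  Adj i i' := i ≠ i' ∧ ∃ j, (i, j) ∈ G ∧ (i', j) ∈ G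
  symm := ⟨fun _ _ ⟨h, j, h1, h2⟩ => ⟨h.symm, j, h2, h1⟩⟩
  loopless := ⟨fun _ h => h.1 rfl⟩

/-- The potential that is 1 on the rows reachable from `i₀` and -1 on the columns they touch
vanishes on `G`, hence everywhere. So every column is touched, and then every row is reachable. -/
theorem Spans.rowGraph_reachable {l k : ℕ} [NeZero k] {G : Set (Fin l × Fin k)}
    (hG : Spans (prodVertex l k) G) (i₀ i : Fin l) : (rowGraph G).Reachable i₀ i ∧
      ∀ j, ∃ i, (i, j) ∈ G := by
  classical
  have h := spans_prodVertex_iff.1 hG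
    (fun i => if (rowGraph G).Reachable i₀ i then 1 else 0)
    (fun j => -(if ∃ i, (rowGraph G).Reachable i₀ i ∧ (i, j) ∈ G then 1 else 0)) (by
      rintro ⟨i, j⟩ he
      rw [add_neg_eq_zero]
      refine if_congr ⟨fun hr => ⟨i, hr, he⟩, ?_⟩ rfl rfl
      rintro ⟨i', hr, he'⟩
      by_cases hii : i' = i
      · exact hii ▸ hr
      · exact hr.trans (SimpleGraph.Adj.reachable ⟨hii, j, he', he⟩))
  have h1 : ∀ j, ∃ i, (rowGraph G).Reachable i₀ i ∧ (i, j) ∈ G := by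
    intro j
    have := h (i₀, j)
    by_contra hne
    simp [hne] at this
  refine ⟨?_, fun j => (h1 j).imp fun i hi => hi.2⟩
  by_contra hne
  have := h (i, 0)
  simp [hne, h1] at this

/-- The difference of two heights, as a linear functional. -/
def heightDiff {ι : Type*} (e e' : ι) : Module.Dual ℝ (ι → ℝ) :=
  LinearMap.proj (R := ℝ) (φ := fun _ : ι => ℝ) e - LinearMap.proj (R := ℝ) (φ := fun _ => ℝ) e'

@[simp]
theorem heightDiff_apply {ι : Type*} (e e' : ι) (h : ι → ℝ) : heightDiff e e' h = h e - h e' :=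
  rfl

open Classical in
/-- The differences of two heights. -/
noncomputable def heightDiffs (ι : Type*) [Fintype ι] : Finset (Module.Dual ℝ (ι → ℝ)) :=
  Finset.univ.image fun p : ι × ι => heightDiff p.1 p.2

theorem heightDiff_mem {ι : Type*} [Fintype ι] (e e' : ι) : heightDiff e e' ∈ heightDiffs ι := by
  classical
  exact Finset.mem_image.2 ⟨(e, e'), Finset.mem_univ _, rfl⟩

open Classical in
theorem zero_mem_heightDiffs (ι : Type*) [Fintype ι] [Nonempty ι] :
    (0 : Module.Dual ℝ (ι → ℝ)) ∈ heightDiffs ι := by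
  have e : ι := Classical.arbitrary ι
  have h : heightDiff e e = 0 := by ext; simp [heightDiff]
  exact h ▸ heightDiff_mem e e

open Classical in
theorem neg_heightDiffs (ι : Type*) [Fintype ι] : -heightDiffs ι = heightDiffs ι := by
  have h : -heightDiffs ι ⊆ heightDiffs ι := by
    intro L hL
    rw [Finset.mem_neg] at hL
    obtain ⟨M, hM, rfl⟩ := hL
    rw [heightDiffs, Finset.mem_image] at hM
    obtain ⟨p, -, rfl⟩ := hM
    rw [show -heightDiff p.1 p.2 = heightDiff p.2 p.1 from neg_sub _ _]
    exact heightDiff_mem _ _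
  refine h.antisymm ?_
  simpa using Finset.neg_subset_neg h

-- A step between rows tight in a common column changes the row potential by a height difference.
-- The functional depends on the walk alone, so it can be evaluated at other heights.
open Classical in
theorem exists_functional_of_walk {l k : ℕ} {G : Set (Fin l × Fin k)} {i₀ i : Fin l}
    (p : (rowGraph G).Walk i₀ i) : ∃ L ∈ p.length • heightDiffs (Fin l × Fin k),
      ∀ (h : Fin l × Fin k → ℝ) (a : Fin l → ℝ) (b : Fin k → ℝ),
        (∀ e ∈ G, a e.1 + b e.2 = h e) → a i - a i₀ = L h := by
  induction p with
  | nil => exact ⟨0, by simp, by simp⟩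
  | @cons u w i hadj p ih =>
    obtain ⟨L, hL, hLh⟩ := ih
    have hadj' := hadj
    obtain ⟨-, j, hu, hw⟩ := hadj'
    refine ⟨L + heightDiff (w, j) (u, j), ?_, fun h a b hab => ?_⟩
    · rw [SimpleGraph.Walk.length_cons, succ_nsmul]
      exact Finset.add_mem_add hL (heightDiff_mem _ _)
    · have h1 := hLh h a b hab
      have h2 := hab _ hu
      have h3 := hab _ hw
      simp only [LinearMap.add_apply, heightDiff_apply] at *
      linarith

open Classical in
/-- The signs of alternating sums of at most `2l` differences determine the regular subdivision. -/
theorem mem_regCells_of_sign_eq {l k : ℕ} [NeZero l] [NeZero k] {h h' : Fin l × Fin k → ℝ}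
    (hsign : ∀ L ∈ (2 * l) • heightDiffs (Fin l × Fin k),
      SignType.sign (L h) = SignType.sign (L h'))
    {G : Set (Fin l × Fin k)} (hG : G ∈ regCells (prodVertex l k) h) :
    G ∈ regCells (prodVertex l k) h' := by
  obtain ⟨hspan, a, b, hle, hab⟩ := mem_regCells_prodVertex_iff.1 hG
  have hreach := hspan.rowGraph_reachable 0
  have hrow := (hreach 0).2
  choose r hr using hrow
  have hL : ∀ i, ∃ L ∈ (l - 1) • heightDiffs (Fin l × Fin k), a i - a 0 = L h := by
    intro i
    obtain ⟨p, hp⟩ := (hreach i).1.exists_isPath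
    obtain ⟨L, hL, hLh⟩ := exists_functional_of_walk p
    have hlen := hp.length_lt
    rw [Fintype.card_fin] at hlen
    exact ⟨L, Finset.nsmul_subset_nsmul_right (zero_mem_heightDiffs _) (by lia) hL,
      hLh h a b fun e he => (hab e).1 he⟩
  choose L hLmem hLh using hL
  have hneg : ∀ i, -L i ∈ (l - 1) • heightDiffs (Fin l × Fin k) := by
    intro i
    rw [← neg_heightDiffs, neg_nsmul]
    exact Finset.neg_mem_neg (hLmem i)
  -- The same functionals at `h'` give the row potential; the column potential makes the chosen row
  -- `r j` tight in column `j`.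
  refine mem_regCells_prodVertex_iff.2 ⟨hspan, fun i => L i h',
    fun j => h' (r j, j) - L (r j) h', ?_⟩
  have key : ∀ i j, SignType.sign (L i h' + (h' (r j, j) - L (r j) h') - h' (i, j)) =
      SignType.sign (a i + b j - h (i, j)) := by
    intro i j
    -- There are 2(l - 1) + 1 differences here; the zero functional pads them to 2l.
    have hM : L i + -L (r j) + heightDiff (r j, j) (i, j) ∈
        (2 * l) • heightDiffs (Fin l × Fin k) := by
      have h1 := Finset.add_mem_add (Finset.add_mem_add (hLmem i) (hneg (r j)))
        (heightDiff_mem (r j, j) (i, j))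
      rw [← add_nsmul, ← succ_nsmul] at h1
      have := NeZero.pos l
      exact Finset.nsmul_subset_nsmul_right (zero_mem_heightDiffs _) (by lia) h1
    have h1 := hsign _ hM
    have h2 := (hab _).1 (hr j)
    simp only [LinearMap.add_apply, heightDiff_apply, LinearMap.neg_apply,
      ← hLh] at h1
    rw [show L i h' + (h' (r j, j) - L (r j) h') - h' (i, j) =
      L i h' + -L (r j) h' + (h' (r j, j) - h' (i, j)) by ring, ← h1]
    congr 1
    simp only at h2
    linarith
  constructor
  · rintro ⟨i, j⟩
    have h1 := key i j
    have h2 := hle (i, j)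
    rcases lt_or_eq_of_le h2 with h2 | h2
    · rw [sign_neg (sub_neg.2 h2), sign_eq_neg_one_iff] at h1
      simp only
      linarith
    · rw [sub_eq_zero.2 h2, sign_zero, sign_eq_zero_iff] at h1
      simp only
      linarith
  · rintro ⟨i, j⟩
    have h1 := key i j
    rw [hab]
    constructor
    · intro h2
      rw [sub_eq_zero.2 h2, sign_zero, sign_eq_zero_iff] at h1
      simp only
      linarith
    · intro h2
      rw [sub_eq_zero.2 h2, sign_zero, eq_comm, sign_eq_zero_iff] at h1
      simp only
      linarith

theorem numRegularSubdivisions_le (l k : ℕ) [NeZero l] [NeZero k] :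
    numRegularSubdivisions l k ≤ (2 * (l * k) ^ (4 * l) + 1) ^ (l * k) := by
  classical
  rw [numRegularSubdivisions_eq]
  set A := (2 * l) • heightDiffs (Fin l × Fin k) with hA
  have hcard : A.card ≤ (l * k) ^ (4 * l) := by
    calc A.card ≤ (heightDiffs (Fin l × Fin k)).card ^ (2 * l) := Finset.card_nsmul_le
      _ ≤ ((l * k) * (l * k)) ^ (2 * l) := by
          refine Nat.pow_le_pow_left (Finset.card_image_le.trans ?_) _
          simp
      _ = (l * k) ^ (4 * l) := by rw [← pow_two, ← pow_mul]; congr 1; lia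
  set F : Fin A.card → Module.Dual ℝ (Fin l × Fin k → ℝ) := fun i => (A.equivFin.symm i).1 with hF
  have hfac : (regCells (prodVertex l k)).FactorsThrough (signVector F) := by
    intro h h' hhh
    have hs : ∀ L ∈ A, SignType.sign (L h) = SignType.sign (L h') := by
      intro L hL
      have := congrFun hhh (A.equivFin ⟨L, hL⟩)
      simpa [signVector, hF] using this
    exact Set.Subset.antisymm (fun G hG => mem_regCells_of_sign_eq hs hG)
      fun G hG => mem_regCells_of_sign_eq (fun L hL => (hs L hL).symm) hG
  obtain ⟨g, hg⟩ := (Function.factorsThrough_iff _).1 hfac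
  rw [hg, Set.range_comp]
  calc _ ≤ (Set.range (signVector F)).ncard := Set.ncard_image_le (Set.toFinite _)
    _ ≤ (2 * A.card + 1) ^ Module.finrank ℝ (Fin l × Fin k → ℝ) := ncard_range_signVector_le _ F
    _ = (2 * A.card + 1) ^ (l * k) := by simp
    _ ≤ _ := Nat.pow_le_pow_left (by lia) _

end UpperBound

/-! ### Lower bound for regular subdivisions, from permutations. -/

section RegularLowerBound

/-- Heights that are `σ` in the row `r` and zero elsewhere. -/
def permHeight {l k : ℕ} (r : Fin l) (σ : Equiv.Perm (Fin k)) (e : Fin l × Fin k) : ℝ :=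
  if e.1 = r then ((σ e.2 : ℕ) : ℝ) else 0

/-- Column `σ.symm m` is tight in all rows and every other column in at least one, which gives the
span. The column potentials are the largest allowed once row `r` has potential `m` and the other
rows 0. -/
theorem mem_regCells_permHeight {l k : ℕ} {r r₀ : Fin l} (hr : r₀ ≠ r) (σ : Equiv.Perm (Fin k))
    (m : Fin k) : {e : Fin l × Fin k | if e.1 = r then σ e.2 ≤ m else m ≤ σ e.2} ∈
      regCells (prodVertex l k) (permHeight r σ) := by
  refine mem_regCells_prodVertex_iff.2 ⟨spans_prodVertex_iff.2 fun a b hab => ?_,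
    fun i => if i = r then ((m : ℕ) : ℝ) else 0, fun j => min 0 (((σ j : ℕ) : ℝ) - (m : ℕ)), ?_, ?_⟩
  · have hm : ∀ i, a i + b (σ.symm m) = 0 := fun i => hab (i, σ.symm m) (by simp)
    have hj : ∀ j, b j = b (σ.symm m) := by
      intro j
      rcases le_total (σ j) m with h | h
      · have h1 := hab (r, j) (by simpa using h)
        simp only at h1
        linarith [hm r]
      · have h1 := hab (r₀, j) (by simpa [hr] using h)
        simp only at h1
        linarith [hm r₀]
    rintro ⟨i, j⟩
    simp only [hj j, hm i]
  · rintro ⟨i, j⟩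
    by_cases hi : i = r
    · simp only [permHeight, hi, if_true]
      linarith [min_le_right (0 : ℝ) (((σ j : ℕ) : ℝ) - (m : ℕ))]
    · simp [permHeight, hi]
  · rintro ⟨i, j⟩
    by_cases hi : i = r
    · have h1 : σ j ≤ m ↔ ((σ j : ℕ) : ℝ) ≤ (m : ℕ) := by rw [Nat.cast_le, Fin.val_fin_le]
      simp only [permHeight, hi, if_true, Set.mem_ofPred_eq, h1]
      constructor
      · intro h
        rw [min_eq_right (by linarith)]
        ring
      · intro h
        have := min_le_left (0 : ℝ) (((σ j : ℕ) : ℝ) - (m : ℕ))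
        linarith
    · have h1 : m ≤ σ j ↔ ((m : ℕ) : ℝ) ≤ (σ j : ℕ) := by rw [Nat.cast_le, Fin.val_fin_le]
      simp only [permHeight, hi, if_false, Set.mem_ofPred_eq, h1, zero_add]
      rw [min_eq_left_iff, sub_nonneg]

/-- If `σ j < σ j'`, the cell at level `σ j'` contains `(r, j)` but not `(r₀, j)`, and both entries
of column `j'`. Read with the heights of `τ`, this says `τ j < τ j'`. -/
theorem regCells_permHeight_injective {l k : ℕ} {r r₀ : Fin l} (hr : r₀ ≠ r) :
    Function.Injective fun σ : Equiv.Perm (Fin k) =>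
      regCells (prodVertex l k) (permHeight r σ) := by
  intro σ τ hστ
  have hlt : ∀ j j', σ j < σ j' → τ j < τ j' := by
    intro j j' hjj
    have hmem := mem_regCells_permHeight hr σ (σ j')
    simp only at hστ
    rw [hστ] at hmem
    obtain ⟨-, a, b, hle, hab⟩ := mem_regCells_prodVertex_iff.1 hmem
    have h1 := (hab (r, j')).1 (by simp)
    have h2 := (hab (r₀, j')).1 (by simp)
    have h3 := (hab (r, j)).1 (by simpa using hjj.le)
    have h4 : a r₀ + b j < 0 := by
      refine lt_of_le_of_ne (by simpa [permHeight, hr] using hle (r₀, j)) fun h0 => ?_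
      have := (hab (r₀, j)).2 (by simpa [permHeight, hr] using h0)
      simp only [Set.mem_ofPred_eq, hr, if_false] at this
      exact absurd hjj (not_lt.2 this)
    simp only [permHeight, hr, if_true, if_false] at h1 h2 h3
    have h5 : ((τ j : ℕ) : ℝ) < (τ j' : ℕ) := by linarith
    exact_mod_cast h5
  have hmono : StrictMono (τ ∘ σ.symm) := fun x y hxy => hlt _ _ (by simpa using hxy)
  have hid : τ ∘ σ.symm = id :=
    (hmono.range_inj strictMono_id).1
      (by rw [Set.range_id, (τ.surjective.comp σ.symm.surjective).range_eq])
  ext j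
  have := congrFun hid (σ j)
  simp only [Function.comp_apply, Equiv.symm_apply_apply, id] at this
  rw [this]

theorem factorial_le_numRegularSubdivisions {l k : ℕ} (hl : 2 ≤ l) [NeZero k] :
    k.factorial ≤ numRegularSubdivisions l k := by
  have : NeZero l := ⟨by lia⟩
  rw [numRegularSubdivisions_eq]
  have hinj := regCells_permHeight_injective (k := k) (r := (⟨1, by lia⟩ : Fin l))
    (r₀ := ⟨0, by lia⟩) (by simp)
  calc k.factorial = (Set.range fun σ : Equiv.Perm (Fin k) =>
        regCells (prodVertex l k) (permHeight (⟨1, by lia⟩ : Fin l) σ)).ncard := by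
        rw [← Set.image_univ, Set.ncard_image_of_injective _ hinj, Set.ncard_univ,
          Nat.card_eq_fintype_card, Fintype.card_perm, Fintype.card_fin]
    _ ≤ _ := by
        refine Set.ncard_le_ncard ?_ (Set.toFinite _)
        rintro _ ⟨σ, rfl⟩
        exact ⟨_, rfl⟩

end RegularLowerBound

/-! ### A regular subdivision with quadratically many hexagonal cells. -/

section Hexagons

/-- The alternating sign on the `6`-cycle with rows `r₀, r₁, r₂` and columns `A, B, C`. -/
noncomputable def hexCoeff {l k : ℕ} (r₀ r₁ r₂ : Fin l) (A B C : Fin k) : Fin l × Fin k → ℝ :=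
  Pi.single (r₀, A) 1 + Pi.single (r₁, C) 1 + Pi.single (r₂, B) 1
    - Pi.single (r₁, A) 1 - Pi.single (r₂, C) 1 - Pi.single (r₀, B) 1

theorem sum_hexCoeff_smul {l k : ℕ} {M : Type*} [AddCommGroup M] [Module ℝ M] (r₀ r₁ r₂ : Fin l)
    (A B C : Fin k) (w : Fin l × Fin k → M) : ∑ e, hexCoeff r₀ r₁ r₂ A B C e • w e =
      w (r₀, A) + w (r₁, C) + w (r₂, B) - w (r₁, A) - w (r₂, C) - w (r₀, B) := by
  simp only [hexCoeff, Pi.add_apply, Pi.sub_apply, add_smul, sub_smul, Finset.sum_add_distrib,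
    Finset.sum_sub_distrib, Pi.single_apply, ite_smul, one_smul, zero_smul, Finset.sum_ite_eq',
    Finset.mem_univ, if_true]

/-- A graph that consists of a `6`-cycle, further rows attached to the column `A`, and further
columns attached to one of the rows of the cycle. -/
theorem isCircuitCell_hexCoeff {l k : ℕ} {G : Set (Fin l × Fin k)} {r₀ r₁ r₂ : Fin l}
    {A B C : Fin k} (h01 : r₀ ≠ r₁) (h02 : r₀ ≠ r₂) (h12 : r₁ ≠ r₂) (hAB : A ≠ B) (hAC : A ≠ C)
    (hBC : B ≠ C) (hA : ∀ i, (i, A) ∈ G ↔ i ≠ r₂) (hB : ∀ i, (i, B) ∈ G ↔ i = r₀ ∨ i = r₂)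
    (hC : ∀ i, (i, C) ∈ G ↔ i = r₁ ∨ i = r₂)
    (hcol : ∀ j, j ≠ A → j ≠ B → j ≠ C →
      ∃ r, (r = r₀ ∨ r = r₁ ∨ r = r₂) ∧ ∀ i, (i, j) ∈ G ↔ i = r) :
    IsCircuitCell (prodVertex l k) G (hexCoeff r₀ r₁ r₂ A B C) where
  supp := by
    rintro ⟨i, j⟩ he
    by_contra hG
    refine he ?_
    have h1 : (i, j) ≠ (r₀, A) := by rintro h; rw [h, hA] at hG; exact hG h02
    have h2 : (i, j) ≠ (r₁, C) := by rintro h; rw [h, hC] at hG; simp at hG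
    have h3 : (i, j) ≠ (r₂, B) := by rintro h; rw [h, hB] at hG; simp at hG
    have h4 : (i, j) ≠ (r₁, A) := by rintro h; rw [h, hA] at hG; exact hG h12
    have h5 : (i, j) ≠ (r₂, C) := by rintro h; rw [h, hC] at hG; simp at hG
    have h6 : (i, j) ≠ (r₀, B) := by rintro h; rw [h, hB] at hG; simp at hG
    simp only [hexCoeff, Pi.add_apply, Pi.sub_apply, Pi.single_eq_of_ne h1, Pi.single_eq_of_ne h2,
      Pi.single_eq_of_ne h3, Pi.single_eq_of_ne h4, Pi.single_eq_of_ne h5, Pi.single_eq_of_ne h6]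
    norm_num
  sum_eq_zero := by
    have := sum_hexCoeff_smul r₀ r₁ r₂ A B C fun _ => (1 : ℝ)
    simp only [smul_eq_mul, mul_one] at this
    rw [this]
    norm_num
  sum_smul_eq_zero := by
    rw [sum_hexCoeff_smul]
    ext x <;> simp only [prodVertex, Prod.fst_add, Prod.fst_sub, Prod.snd_add, Prod.snd_sub,
      Pi.add_apply, Pi.sub_apply, Prod.fst_zero, Prod.snd_zero, Pi.zero_apply] <;> ring
  exists_pos := ⟨(r₀, A), by simp [hexCoeff, h01, h02, hAB, hAC]⟩
  exists_extend := by
    intro w hw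
    have hrel := sum_hexCoeff_smul r₀ r₁ r₂ A B C w
    simp only [smul_eq_mul] at hrel
    rw [hw] at hrel
    have : Nonempty (Fin l) := ⟨r₀⟩
    choose! r hr hrG using hcol
    -- Normalise by `a r₀ = 0` and propagate the values along the edges.
    set a : Fin l → ℝ := fun i => if i = r₂ then w (r₂, B) - w (r₀, B) else w (i, A) - w (r₀, A)
      with ha
    set b : Fin k → ℝ := fun j => if j = A then w (r₀, A) else if j = B then w (r₀, B) else
      if j = C then w (r₁, C) - a r₁ else w (r j, j) - a (r j) with hb
    have ha2 : a r₂ = w (r₂, B) - w (r₀, B) := by simp [ha]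
    have ha' : ∀ i, i ≠ r₂ → a i = w (i, A) - w (r₀, A) := fun i hi => by simp [ha, hi]
    refine ⟨potential a b, ?_⟩
    rintro ⟨i, j⟩ he
    rw [potential_prodVertex]
    by_cases hjA : j = A
    · subst hjA
      have hbj : b j = w (r₀, j) := by simp [hb]
      simp only [hbj, ha' i ((hA i).1 he)]
      ring
    by_cases hjB : j = B
    · subst hjB
      have hbj : b j = w (r₀, j) := by simp [hb, hjA]
      rcases (hB i).1 he with rfl | rfl
      · simp only [hbj, ha' i h02]
        ring
      · simp only [hbj, ha2]
        ring
    by_cases hjC : j = C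
    · subst hjC
      have hbj : b j = w (r₁, j) - a r₁ := by simp [hb, hjA, hjB]
      rcases (hC i).1 he with rfl | rfl
      · simp only [hbj]
        ring
      -- The edge `(r₂, C)` closes the cycle; only here is the orthogonality of `w` to the
      -- dependence needed.
      · simp only [hbj, ha2, ha' r₁ h12]
        linarith
    · have hbj : b j = w (r j, j) - a (r j) := by simp [hb, hjA, hjB, hjC]
      have hi := (hrG j hjA hjB hjC i).1 he
      subst hi
      simp only [hbj]
      ring
  nonneg := by
    intro f hf0 hfG
    obtain ⟨a, b, hab⟩ := exists_potential f
    simp only [hab] at hf0 hfG ⊢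
    have h1 := hf0 (r₀, A) (by simp [hexCoeff, h01, h02, hAB, hAC])
    have h2 := hf0 (r₁, C) (by
      simp [hexCoeff, h01.symm, h12, hAC.symm, hBC.symm])
    have h3 := hf0 (r₂, B) (by
      simp [hexCoeff, h02.symm, h12.symm, hAB.symm, hBC])
    have h4 := hf0 (r₁, A) (by simp [hexCoeff, h01.symm, h12, hAB, hAC])
    have h5 := hf0 (r₂, C) (by
      simp [hexCoeff, h02.symm, h12.symm, hAC.symm, hBC.symm])
    have h6 := hf0 (r₀, B) (by simp [hexCoeff, h01, h02, hAB.symm, hBC])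
    simp only at h1 h2 h3 h4 h5 h6
    rintro ⟨i, j⟩
    -- On the cycle all row potentials equal `a r₀` and all column potentials `-a r₀`. Everything
    -- else hangs directly on the cycle, so its potential can only be larger.
    have hi : a r₀ ≤ a i := by
      by_cases hi : i = r₂
      · subst hi; linarith
      · have := hfG (i, A) ((hA i).2 hi)
        simp only at this
        linarith
    have hj : 0 ≤ a r₀ + b j := by
      by_cases hjA : j = A
      · subst hjA; linarith
      by_cases hjB : j = B
      · subst hjB; linarith
      by_cases hjC : j = C
      · subst hjC; linarith
      obtain ⟨r, hr, hrG⟩ := hcol j hjA hjB hjC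
      have := hfG (r, j) ((hrG r).2 rfl)
      simp only at this
      rcases hr with rfl | rfl | rfl <;> linarith
    simp only
    linarith

/-- Heights whose regular subdivision has a hexagonal cell for each pair `s, t < n`. -/
def hexHeight (n i j : ℕ) : ℤ :=
  if j < n then if i = 0 then 0 else if i = 1 then 2 * j else if i = 2 then 10 * n else j
  else if j < 2 * n then if i = 0 then 0 else if i = 2 then 2 * (j - n) else 10 * n
  else if j < 4 * n then if i = 1 then 0 else if i = 2 then 2 * (j - 2 * n) - 2 * n else 10 * n
  else if i = 0 then 0 else 10 * n

/-- The row potential of a hexagonal cell. -/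
def hexRow (s t i : ℕ) : ℤ :=
  if i = 0 then 0 else if i = 1 then 2 * s else if i = 2 then 2 * t else s

/-- The column potential of a hexagonal cell. -/
def hexCol (n s t j : ℕ) : ℤ :=
  if j < n then min 0 (2 * j - 2 * s)
  else if j < 2 * n then min 0 (2 * (j - n) - 2 * t)
  else if j < 4 * n then min (-(2 * s)) (2 * (j - 2 * n) - 2 * n - 2 * t)
  else 0

/-- The tight graph of a hexagonal cell. -/
def hexGraph (l k n s t : ℕ) : Set (Fin l × Fin k) :=
  {e | hexRow s t e.1 + hexCol n s t e.2 = hexHeight n e.1 e.2}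

/-- In the column blocks of lengths n, n, 2n, the competing rows among 0, 1, 2 are 0-1, 0-2 and 1-2;
the height 10n excludes the third. Row potentials 0, 2s, 2t make the competitors tie in exactly one
column of each block, namely s, n + t and 3n + t - s, and these ties form the 6-cycle. The last
block is longer because t - s ranges over (-n, n). In the first block rows i ≥ 3 have the mean
height and mean potential of rows 0 and 1, so they are tight only at column s; the factors 2 keep
the means integral. -/
theorem hexRow_add_hexCol_le {n s t : ℕ} (hs : s < n) (ht : t < n) (i j : ℕ) :
    hexRow s t i + hexCol n s t j ≤ hexHeight n i j := by
  simp only [hexRow, hexCol, hexHeight]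
  split_ifs <;> omega

theorem isCircuitCell_hexGraph {l k n s t : ℕ} (hl : 3 ≤ l) (hk : 4 * n ≤ k) (hs : s < n)
    (ht : t < n) : ∃ c, IsCircuitCell (prodVertex l k) (hexGraph l k n s t) c := by
  refine ⟨_, isCircuitCell_hexCoeff (r₀ := (⟨0, by lia⟩ : Fin l)) (r₁ := ⟨1, by lia⟩)
    (r₂ := ⟨2, by lia⟩) (A := (⟨s, by lia⟩ : Fin k)) (B := ⟨n + t, by lia⟩)
    (C := ⟨3 * n + t - s, by lia⟩) (by simp) (by simp) (by simp) ?_ ?_ ?_ ?_ ?_ ?_ ?_⟩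
  · simp only [ne_eq, Fin.mk.injEq]; omega
  · simp only [ne_eq, Fin.mk.injEq]; omega
  · simp only [ne_eq, Fin.mk.injEq]; omega
  · rintro ⟨i, hi⟩
    simp only [hexGraph, Set.mem_ofPred_eq, hexRow, hexCol, hexHeight, ne_eq, Fin.mk.injEq]
    split_ifs <;> omega
  · rintro ⟨i, hi⟩
    simp only [hexGraph, Set.mem_ofPred_eq, hexRow, hexCol, hexHeight, Fin.mk.injEq]
    split_ifs <;> omega
  · rintro ⟨i, hi⟩
    simp only [hexGraph, Set.mem_ofPred_eq, hexRow, hexCol, hexHeight, Fin.mk.injEq]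
    split_ifs <;> omega
  · rintro ⟨j, hj⟩ hjA hjB hjC
    simp only [ne_eq, Fin.mk.injEq] at hjA hjB hjC
    have key : ∃ r < 3, ∀ i : ℕ, hexRow s t i + hexCol n s t j = hexHeight n i j ↔ i = r := by
      refine ⟨if j < n then (if j < s then 1 else 0) else if j < 2 * n then
        (if j < n + t then 2 else 0) else if j < 4 * n then
        (if j < 3 * n + t - s then 2 else 1) else 0, by split_ifs <;> omega, fun i => ?_⟩
      simp only [hexRow, hexCol, hexHeight]
      split_ifs <;> omega
    obtain ⟨r, hr, hrG⟩ := key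
    refine ⟨⟨r, by lia⟩, ?_, fun i => (hrG i).trans (by rw [Fin.ext_iff])⟩
    simp only [Fin.mk.injEq]
    omega

theorem hexGraph_mem_regCells {l k n s t : ℕ} (hl : 3 ≤ l) (hk : 4 * n ≤ k) (hs : s < n)
    (ht : t < n) : hexGraph l k n s t ∈
      regCells (prodVertex l k) fun e => (hexHeight n e.1 e.2 : ℝ) := by
  obtain ⟨c, hc⟩ := isCircuitCell_hexGraph hl hk hs ht
  refine mem_regCells_prodVertex_iff.2 ⟨hc.spans, fun i => hexRow s t i,
    fun j => hexCol n s t j, fun e => ?_, fun e => ?_⟩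
  · simp only
    exact_mod_cast hexRow_add_hexCol_le hs ht e.1 e.2
  · rw [← Int.cast_add, Int.cast_inj]
    rfl

/-- The ties of rows 0 and 1 in the first block and of rows 0 and 2 in the second reveal `s` and
`t`. -/
theorem hexGraph_injective {l k n : ℕ} (hl : 3 ≤ l) (hk : 4 * n ≤ k) :
    Function.Injective fun p : Fin n × Fin n => hexGraph l k n p.1 p.2 := by
  rintro ⟨⟨s, hs⟩, ⟨t, ht⟩⟩ ⟨⟨s', hs'⟩, ⟨t', ht'⟩⟩ h
  simp only at h
  have key : ∀ i j (hi : i < l) (hj : j < k),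
      hexRow s t i + hexCol n s t j = hexHeight n i j →
      hexRow s' t' i + hexCol n s' t' j = hexHeight n i j := by
    intro i j hi hj he
    have : ((⟨i, hi⟩, ⟨j, hj⟩) : Fin l × Fin k) ∈ hexGraph l k n s t := he
    rw [h] at this
    exact this
  have h1 := key 0 s (by lia) (by lia)
  have h2 := key 1 s (by lia) (by lia)
  have h3 := key 0 (n + t) (by lia) (by lia)
  have h4 := key 2 (n + t) (by lia) (by lia)
  simp only [hexRow, hexCol, hexHeight] at h1 h2 h3 h4
  simp only [Prod.mk.injEq, Fin.mk.injEq]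
  constructor
  · clear h3 h4
    simp [hs] at h1 h2
    omega
  · clear h1 h2
    simp [show n + t < 2 * n by lia] at h3 h4
    omega

theorem two_pow_le_numSubdivisions {l k n : ℕ} (hl : 3 ≤ l) (hk : 4 * n ≤ k) [NeZero k] :
    2 ^ (n * n) ≤ numSubdivisions l k := by
  have : NeZero l := ⟨by lia⟩
  have hex : ∀ p : Fin n × Fin n, ∃ c,
      IsCircuitCell (prodVertex l k) (hexGraph l k n p.1 p.2) c :=
    fun p => isCircuitCell_hexGraph hl hk p.1.2 p.2.2
  choose c hc using hex
  have h := two_pow_card_le_ncard_isPolySubdivision (prodVertex_injective l k)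
    (simplexProd_eq_convexHull l k) (extremePoints_simplexProd l k) (hexGraph_injective hl hk)
    (fun p => hexGraph_mem_regCells hl hk p.1.2 p.2.2) hc
  simpa [numSubdivisions] using h

end Hexagons

/-! ### Comparison of the growth rates. -/

section Asymptotics

/-- From `k^k ≤ k! e^k` and `e^k ≤ k^(k/2)`; the latter needs `log k ≥ 2`, and 9 > e². -/
theorem eventually_rpow_le_factorial :
    ∀ᶠ k : ℕ in atTop, (k : ℝ) ^ ((1 / 2 : ℝ) * k) ≤ (k.factorial : ℝ) := by
  filter_upwards [eventually_ge_atTop (9 : ℕ)] with k hk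
  have hk0 : (0 : ℝ) < k := by positivity
  have hk9 : (9 : ℝ) ≤ k := by exact_mod_cast hk
  have h1 := Real.pow_div_factorial_le_exp (k : ℝ) hk0.le k
  rw [div_le_iff₀ (by positivity)] at h1
  have h3 : Real.exp k ≤ (k : ℝ) ^ ((1 / 2 : ℝ) * k) := by
    rw [Real.rpow_def_of_pos hk0, Real.exp_le_exp]
    have h4 : 2 ≤ Real.log k := by
      rw [Real.le_log_iff_exp_le hk0]
      have h5 := Real.exp_one_lt_d9
      have h6 : Real.exp 2 = Real.exp 1 * Real.exp 1 := by rw [← Real.exp_add]; norm_num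
      nlinarith [Real.exp_pos 1]
    nlinarith
  have h7 : (k : ℝ) ^ ((1 / 2 : ℝ) * k) * (k : ℝ) ^ ((1 / 2 : ℝ) * k) = (k : ℝ) ^ k := by
    rw [← Real.rpow_add hk0, ← Real.rpow_natCast]
    congr 1
    ring
  have hpos : 0 < (k : ℝ) ^ ((1 / 2 : ℝ) * k) := Real.rpow_pos_of_pos hk0 _
  rw [← h7] at h1
  have h8 : (k : ℝ) ^ ((1 / 2 : ℝ) * k) * (k : ℝ) ^ ((1 / 2 : ℝ) * k) ≤
      (k : ℝ) ^ ((1 / 2 : ℝ) * k) * k.factorial :=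
    h1.trans (mul_le_mul_of_nonneg_right h3 (by positivity))
  exact le_of_mul_le_mul_left h8 hpos

theorem numRegularSubdivisions_le_rpow {l k : ℕ} (hl : 1 ≤ l) (hlk : l ≤ k) (hk : 3 ≤ k) :
    (numRegularSubdivisions l k : ℝ) ≤ (k : ℝ) ^ (((8 * l + 1) * l : ℝ) * (k : ℝ)) := by
  have : NeZero l := ⟨by lia⟩
  have : NeZero k := ⟨by lia⟩
  -- `l ≤ k` absorbs the base `l`, and `k ≥ 3` absorbs the factor 2 and the summand 1.
  have h1 : 2 * (l * k) ^ (4 * l) + 1 ≤ k ^ (8 * l + 1) := by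
    have h2 : (l * k) ^ (4 * l) ≤ k ^ (8 * l) := by
      calc (l * k) ^ (4 * l) ≤ (k * k) ^ (4 * l) :=
            Nat.pow_le_pow_left (Nat.mul_le_mul_right k hlk) _
        _ = k ^ (8 * l) := by rw [← pow_two, ← pow_mul]; congr 1; ring
    have h3 : 1 ≤ k ^ (8 * l) := Nat.one_le_pow _ _ (by lia)
    rw [pow_succ]
    nlinarith
  have h2 : numRegularSubdivisions l k ≤ k ^ ((8 * l + 1) * (l * k)) := by
    rw [pow_mul]
    exact (numRegularSubdivisions_le l k).trans (Nat.pow_le_pow_left h1 _)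
  calc (numRegularSubdivisions l k : ℝ) ≤ (k : ℝ) ^ ((8 * l + 1) * (l * k)) := by
        exact_mod_cast h2
    _ = _ := by
        rw [← Real.rpow_natCast]
        congr 1
        push_cast
        ring

theorem two_rpow_le_numSubdivisions {l k : ℕ} (hl : 3 ≤ l) (hk : 4 ≤ k) :
    (2 : ℝ) ^ ((1 / 64 : ℝ) * (k : ℝ) ^ 2) ≤ (numSubdivisions l k : ℝ) := by
  have : NeZero k := ⟨by lia⟩
  have h1 := two_pow_le_numSubdivisions (k := k) (n := k / 4) hl (by lia)
  -- Rounding down costs at most a factor 2 once `k ≥ 4`, whence the constant 1/64 = 1/8².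
  have h2 : (k : ℝ) ≤ 8 * (k / 4 : ℕ) := by
    have : k ≤ 8 * (k / 4) := by lia
    exact_mod_cast this
  calc (2 : ℝ) ^ ((1 / 64 : ℝ) * (k : ℝ) ^ 2) ≤ (2 : ℝ) ^ (((k / 4 * (k / 4) : ℕ)) : ℝ) := by
        refine Real.rpow_le_rpow_of_exponent_le (by norm_num) ?_
        rw [Nat.cast_mul]
        nlinarith [Nat.cast_nonneg (α := ℝ) k]
    _ = ((2 ^ (k / 4 * (k / 4)) : ℕ) : ℝ) := by rw [Real.rpow_natCast]; norm_num
    _ ≤ _ := by exact_mod_cast h1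

theorem eventually_rpow_le_two_rpow (C : ℝ) {c : ℝ} (hc : 0 < c) :
    ∀ᶠ k : ℕ in atTop, (k : ℝ) ^ (C * k) ≤ (2 : ℝ) ^ (c * (k : ℝ) ^ 2) := by
  have h2 : 0 < Real.log 2 := Real.log_pos (by norm_num)
  have hC : 0 < |C| + 1 := by positivity
  -- After taking logarithms the claim is `C log k ≤ c k log 2`; `|C| + 1` is a positive stand-in
  -- for `C`.
  have ho := Real.isLittleO_log_id_atTop.bound (show 0 < c * Real.log 2 / (|C| + 1) by positivity)
  filter_upwards [tendsto_natCast_atTop_atTop.eventually ho, eventually_ge_atTop 1] with k hk hk1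
  have hk0 : (1 : ℝ) ≤ k := by exact_mod_cast hk1
  have hlog : 0 ≤ Real.log k := Real.log_nonneg hk0
  simp only [id, Real.norm_eq_abs, abs_of_nonneg hlog, abs_of_nonneg (zero_le_one.trans hk0)] at hk
  rw [div_mul_eq_mul_div, le_div_iff₀ hC] at hk
  rw [Real.rpow_def_of_pos (by linarith), Real.rpow_def_of_pos (by norm_num), Real.exp_le_exp]
  have h3 : Real.log k * C ≤ c * Real.log 2 * k := by
    nlinarith [le_abs_self C]
  nlinarith

theorem numSubdivisions_eq_add (l k : ℕ) :
    numSubdivisions l k = numRegularSubdivisions l k + numNonregularSubdivisions l k := by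
  have hfin := finite_isPolySubdivision (finite_extremePoints_simplexProd l k)
  rw [numSubdivisions, numRegularSubdivisions, numNonregularSubdivisions, ← Set.ncard_union_eq
    (Set.disjoint_left.2 fun S h h' => h'.2 h) (hfin.subset fun S hS => hS.1)
    (hfin.subset fun S hS => hS.1)]
  congr 1
  ext S
  constructor
  · intro hS
    by_cases h : IsRegularSubdivision (simplexProd l k) S
    · exact Or.inl h
    · exact Or.inr ⟨hS, h⟩
  · rintro (h | h)
    · exact h.1
    · exact h.1

theorem eventually_numRegularSubdivisions_le {l : ℕ} (hl : 1 ≤ l) {c : ℝ} (hc : 0 < c) :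
    ∀ᶠ k : ℕ in atTop, (numRegularSubdivisions l k : ℝ) ≤ (2 : ℝ) ^ (c * (k : ℝ) ^ 2) := by
  filter_upwards [eventually_rpow_le_two_rpow ((8 * l + 1) * l : ℝ) hc, eventually_ge_atTop l,
    eventually_ge_atTop 3] with k h1 h2 h3
  exact (numRegularSubdivisions_le_rpow hl h2 h3).trans h1

/-- With `x = 2^(k²/128)` there are at least `x²` subdivisions and at most `x` regular ones, and `x²
- x ≥ x` as soon as `x ≥ 2`; `k ≥ 12` suffices since 12² ≥ 128. -/
theorem two_rpow_le_numNonregularSubdivisions {l : ℕ} (hl : 3 ≤ l) : ∀ᶠ k : ℕ in atTop,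
    (2 : ℝ) ^ ((1 / 128 : ℝ) * (k : ℝ) ^ 2) ≤ (numNonregularSubdivisions l k : ℝ) := by
  filter_upwards [eventually_numRegularSubdivisions_le (l := l) (by lia)
    (show (0 : ℝ) < 1 / 128 by norm_num), eventually_ge_atTop 12] with k h1 h2
  have h3 := two_rpow_le_numSubdivisions hl (show 4 ≤ k by lia)
  have h4 : (numSubdivisions l k : ℝ) =
      numRegularSubdivisions l k + numNonregularSubdivisions l k := by
    exact_mod_cast numSubdivisions_eq_add l k
  set x := (2 : ℝ) ^ ((1 / 128 : ℝ) * (k : ℝ) ^ 2) with hx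
  have h5 : (2 : ℝ) ^ ((1 / 64 : ℝ) * (k : ℝ) ^ 2) = x * x := by
    rw [hx, ← Real.rpow_add (by norm_num)]
    congr 1
    ring
  have h6 : 2 ≤ x := by
    have hk : (12 : ℝ) ≤ k := by exact_mod_cast h2
    calc (2 : ℝ) = (2 : ℝ) ^ (1 : ℝ) := (Real.rpow_one 2).symm
      _ ≤ x := Real.rpow_le_rpow_of_exponent_le (by norm_num) (by nlinarith)
  nlinarith

theorem tendsto_numRegularSubdivisions_div {l : ℕ} (hl : 3 ≤ l) :
    Tendsto (fun k : ℕ => (numRegularSubdivisions l k : ℝ) / (numSubdivisions l k : ℝ))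
      atTop (𝓝 0) := by
  have hlim : Tendsto (fun k : ℕ => ((1 / 2 : ℝ) ^ (1 / 128 : ℝ)) ^ k) atTop (𝓝 0) :=
    tendsto_pow_atTop_nhds_zero_of_lt_one (by positivity)
      (Real.rpow_lt_one (by norm_num) (by norm_num) (by norm_num))
  refine squeeze_zero' (Eventually.of_forall fun k => by positivity) ?_ hlim
  filter_upwards [eventually_numRegularSubdivisions_le (l := l) (by lia)
    (show (0 : ℝ) < 1 / 128 by norm_num), eventually_ge_atTop 4] with k h1 h2
  have h3 := two_rpow_le_numSubdivisions hl h2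
  have hk : (1 : ℝ) ≤ k := by exact_mod_cast (show 1 ≤ k by lia)
  have h4 : (2 : ℝ) ^ ((1 / 64 : ℝ) * (k : ℝ) ^ 2) =
      (2 : ℝ) ^ ((1 / 128 : ℝ) * (k : ℝ) ^ 2) * (2 : ℝ) ^ ((1 / 128 : ℝ) * (k : ℝ) ^ 2) := by
    rw [← Real.rpow_add (by norm_num)]
    congr 1
    ring
  have hpos : (0 : ℝ) < (2 : ℝ) ^ ((1 / 128 : ℝ) * (k : ℝ) ^ 2) := by positivity
  calc (numRegularSubdivisions l k : ℝ) / (numSubdivisions l k : ℝ)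
      ≤ (2 : ℝ) ^ ((1 / 128 : ℝ) * (k : ℝ) ^ 2) / (2 : ℝ) ^ ((1 / 64 : ℝ) * (k : ℝ) ^ 2) :=
        div_le_div₀ hpos.le h1 (by positivity) h3
    _ = ((2 : ℝ) ^ ((1 / 128 : ℝ) * (k : ℝ) ^ 2))⁻¹ := by
        rw [h4]
        field_simp
    -- Weakening `k²` to `k` leaves a geometric sequence.
    _ ≤ ((2 : ℝ) ^ ((1 / 128 : ℝ) * (k : ℝ)))⁻¹ := by
        refine inv_anti₀ (by positivity) (Real.rpow_le_rpow_of_exponent_le (by norm_num) ?_)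
        nlinarith
    _ = ((1 / 2 : ℝ) ^ (1 / 128 : ℝ)) ^ k := by
        rw [← Real.rpow_natCast, ← Real.rpow_mul (by norm_num), one_div (2 : ℝ),
          Real.inv_rpow (by norm_num)]

end Asymptotics

theorem mainTheorem3 :
    (∀ l : ℕ, 2 ≤ l → ∃ c C : ℝ, 0 < c ∧ 0 < C ∧ ∀ᶠ k : ℕ in atTop,
      (k : ℝ) ^ (c * (k : ℝ)) ≤ (numRegularSubdivisions l k : ℝ) ∧
      (numRegularSubdivisions l k : ℝ) ≤ (k : ℝ) ^ (C * (k : ℝ))) ∧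
    (∀ l : ℕ, 3 ≤ l →
      (∃ c : ℝ, 0 < c ∧ ∀ᶠ k : ℕ in atTop,
        (2 : ℝ) ^ (c * (k : ℝ) ^ 2) ≤ (numSubdivisions l k : ℝ)) ∧
      (∃ c : ℝ, 0 < c ∧ ∀ᶠ k : ℕ in atTop,
        (2 : ℝ) ^ (c * (k : ℝ) ^ 2) ≤ (numNonregularSubdivisions l k : ℝ)) ∧
      Tendsto (fun k : ℕ => (numRegularSubdivisions l k : ℝ) / (numSubdivisions l k : ℝ))
        atTop (𝓝 0)) := by
  refine ⟨fun l hl => ⟨1 / 2, (8 * l + 1) * l, by norm_num, ?_, ?_⟩, fun l hl => ⟨⟨1 / 64,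
    by norm_num, ?_⟩, ⟨1 / 128, by norm_num, two_rpow_le_numNonregularSubdivisions hl⟩,
    tendsto_numRegularSubdivisions_div hl⟩⟩
  · have : (0 : ℝ) < l := by exact_mod_cast (show 0 < l by lia)
    positivity
  · filter_upwards [eventually_rpow_le_factorial, eventually_ge_atTop l,
      eventually_ge_atTop 3] with k h1 h2 h3
    have : NeZero k := ⟨by lia⟩
    refine ⟨h1.trans ?_, numRegularSubdivisions_le_rpow (by lia) h2 h3⟩
    exact_mod_cast factorial_le_numRegularSubdivisions hl
  · filter_upwards [eventually_ge_atTop 4] with k hk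
    exact two_rpow_le_numSubdivisions hl hk
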